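/- There is an absolute constant $C>0$ such that every finite simple graph $G$ with average degree $2e(G)/|V(G)|$ at least $C$ contains two nested cycles without crossings, that is, two edge-disjoint cycles $C_1$ and $C_2$ such that $V(C_2)\subseteq V(C_1)$ and, writing $C_1=v_1v_2\dots v_\ell$ in cyclic order, there are no two edges $v_iv_{i'}$ and $v_jv_{j'}$ of $C_2$ with $i<j<i'<j'$. Equivalently, there is an absolute constant $C'>0$ such that, for every $n\ge 1$, every simple graph with $n$ vertices and at least $C'n$ edges contains two such cycles. -/

import Mathlib

universe u

namespace SimpleGraph

/-- The average degree `2 e(G) / |V(G)|` of a finite graph. -/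
noncomputable def averageDegree {V : Type*} [Fintype V] (G : SimpleGraph V)
    [DecidableRel G.Adj] : ℝ :=
  2 * (G.edgeFinset.card : ℝ) / (Fintype.card V : ℝ)

/-- `c₁` and `c₂` are two nested cycles without crossings in `G`: both are cycles of `G`, the
vertex set of `c₂` (inner) is contained in that of `c₁` (outer), their edge sets are disjoint, and,
writing `c₁ = v₀ v₁ … v_{ℓ-1}` in cyclic order, no two edges `v_i v_{i'}` and `v_j v_{j'}` of `c₂`
satisfy `i < j < i' < j'`. -/
structure IsNestedWithoutCrossings {V : Type*} {G : SimpleGraph V} {u w : V}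
    (c₁ : G.Walk u u) (c₂ : G.Walk w w) : Prop where
  isCycle_outer : c₁.IsCycle
  isCycle_inner : c₂.IsCycle
  nested : ∀ x ∈ c₂.support, x ∈ c₁.support
  edge_disjoint : ∀ e ∈ c₂.edges, e ∉ c₁.edges
  no_crossing : ∀ i j i' j' : ℕ, i < j → j < i' → i' < j' → j' < c₁.length →
    ¬ (s(c₁.getVert i, c₁.getVert i') ∈ c₂.edges ∧ s(c₁.getVert j, c₁.getVert j') ∈ c₂.edges)

/-- `G` contains two (edge-disjoint) nested cycles without crossings. -/
def HasNestedCyclesWithoutCrossings {V : Type*} (G : SimpleGraph V) : Prop :=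
  ∃ (u w : V) (c₁ : G.Walk u u) (c₂ : G.Walk w w), IsNestedWithoutCrossings c₁ c₂

end SimpleGraph

/-! The inner cycle is a shortest cycle `c` of a suitable dense subgraph. The outer cycle arises by
replacing every edge of `c` with a detour off `c`, the detours being pairwise disjoint. It then
visits the vertices of `c` in their own order, so the edges of `c` join consecutive stops (or the
last and the first) and cannot cross; and each edge of the outer cycle has an end off `c`, so the
cycles are edge-disjoint.

The subgraph is a core (`exists_isCore`): girth exactly `g`, huge minimum degree, and no separation
of order at most `3 g` with both sides of size at least `6 g`. It comes from an extremal choice: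
first the largest `g`, then the smallest vertex set, for which a density condition with a slack
linear in `g` holds. The Moore-type bound `GirthAtLeast.lt_card_of_dense` keeps dense sets larger
than `6 g`, and conversely makes sets of size at most `6 g` sparse.

The detours come from a linkage argument. A core has a complete minor of order `5 g`
(`GirthAtLeast.exists_isCliqueModel`): clusters of radius proportional to `g` induce forests,
contain many vertices and are pairwise joined by at most one edge, so contracting them gives a graph
of average degree exponential in `g`, to which Mader's theorem applies. At most `g` branch sets meet
`c`. Delete `c` and attach two terminals per edge of `c`, copies of its ends, `2 g` in all. Few
vertices cannot separate the terminals from the remaining `4 g` branch sets (`IsCore.wellAttached`),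
because a small side of a separation is too sparse for the minimum degree. The Robertson–Seymour
type lemma `WellAttached.linked`, proved by contraction and Menger's theorem, then links the
terminals in the prescribed pairs. -/

namespace SimpleGraph

open scoped Classical

variable {V : Type*}

/-! ### Connected sets and separations -/

/-- `S` induces a preconnected subgraph: a nonempty subset of `S` closed under adjacency inside `S`
is all of `S`. -/
def ConnOn (G : SimpleGraph V) (S : Set V) : Prop :=
  ∀ U ⊆ S, U.Nonempty → (∀ x ∈ U, ∀ y ∈ S, G.Adj x y → y ∈ U) → S ⊆ U

/-- The edges of `G` with both ends in `W`. -/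
def within (G : SimpleGraph V) (W : Set V) : SimpleGraph V where
  Adj x y := G.Adj x y ∧ x ∈ W ∧ y ∈ W
  symm := ⟨fun _ _ h => ⟨h.1.symm, h.2.2, h.2.1⟩⟩
  loopless := ⟨fun _ h => h.1.ne rfl⟩

/-- `(A, B)` is a separation of `G`. -/
structure IsSeparation (G : SimpleGraph V) (A B : Finset V) : Prop where
  cover : ∀ x, x ∈ A ∨ x ∈ B
  edge : ∀ x y, G.Adj x y → (x ∈ A ∧ y ∈ A) ∨ (x ∈ B ∧ y ∈ B)

theorem connOn_empty (G : SimpleGraph V) : G.ConnOn ∅ := fun _ _ _ _ => Set.empty_subset _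

theorem connOn_singleton (G : SimpleGraph V) (v : V) : G.ConnOn {v} := by
  rintro U hU ⟨x, hx⟩ - y hy
  rw [Set.mem_singleton_iff.1 hy, ← Set.mem_singleton_iff.1 (hU hx)]
  exact hx

theorem ConnOn.mono {G H : SimpleGraph V} (h : G ≤ H) {S : Set V} (hS : G.ConnOn S) :
    H.ConnOn S :=
  fun U hU hne hcl => hS U hU hne fun x hx y hy hxy => hcl x hx y hy (h hxy)

/-- Two connected sets that share a vertex or are joined by an edge have connected union. -/
theorem ConnOn.union {G : SimpleGraph V} {S T : Set V} (hS : G.ConnOn S) (hT : G.ConnOn T)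
    {x y : V} (hx : x ∈ S) (hy : y ∈ T) (hxy : x = y ∨ G.Adj x y) : G.ConnOn (S ∪ T) := by
  intro U hU hne hcl
  have hs : (U ∩ S).Nonempty → S ⊆ U := fun h =>
    (hS (U ∩ S) Set.inter_subset_right h
      fun a ha b hb hab => ⟨hcl a ha.1 b (.inl hb) hab, hb⟩).trans Set.inter_subset_left
  have ht : (U ∩ T).Nonempty → T ⊆ U := fun h =>
    (hT (U ∩ T) Set.inter_subset_right h
      fun a ha b hb hab => ⟨hcl a ha.1 b (.inr hb) hab, hb⟩).trans Set.inter_subset_left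
  have key : S ⊆ U ∨ T ⊆ U := by
    obtain ⟨a, ha⟩ := hne
    rcases hU ha with h | h
    exacts [.inl (hs ⟨a, ha, h⟩), .inr (ht ⟨a, ha, h⟩)]
  rcases key with h | h
  · refine Set.union_subset h (ht ⟨y, ?_, hy⟩)
    rcases hxy with rfl | hxy
    exacts [h hx, hcl x (h hx) y (.inr hy) hxy]
  · refine Set.union_subset (hs ⟨x, ?_, hx⟩) h
    rcases hxy with rfl | hxy
    exacts [h hy, hcl y (h hy) x (.inl hx) hxy.symm]

/-- Connected sets that all meet a connected set have connected union with it. -/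
theorem ConnOn.union_iUnion {G : SimpleGraph V} {ι : Type*} {S : Set V} (hS : G.ConnOn S)
    {T : ι → Set V} (hT : ∀ i, G.ConnOn (T i)) (hST : ∀ i, (S ∩ T i).Nonempty) :
    G.ConnOn (S ∪ ⋃ i, T i) := by
  intro U hU hne hcl
  have ht : ∀ i, (U ∩ T i).Nonempty → T i ⊆ U := fun i h =>
    (hT i (U ∩ T i) Set.inter_subset_right h
      fun a ha b hb hab => ⟨hcl a ha.1 b (.inr (Set.mem_iUnion_of_mem i hb)) hab, hb⟩).trans
        Set.inter_subset_left
  have hs : (U ∩ S).Nonempty → S ⊆ U := fun h =>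
    (hS (U ∩ S) Set.inter_subset_right h
      fun a ha b hb hab => ⟨hcl a ha.1 b (.inl hb) hab, hb⟩).trans Set.inter_subset_left
  have hSU : S ⊆ U := by
    obtain ⟨a, ha⟩ := hne
    rcases hU ha with h | h
    · exact hs ⟨a, ha, h⟩
    · obtain ⟨i, hi⟩ := Set.mem_iUnion.1 h
      obtain ⟨b, hb, hb'⟩ := hST i
      exact hs ⟨b, ht i ⟨a, ha, hi⟩ hb', hb⟩
  refine Set.union_subset hSU (Set.iUnion_subset fun i => ht i ?_)
  obtain ⟨b, hb, hb'⟩ := hST i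
  exact ⟨b, hSU hb, hb'⟩

/-- A connected set of `G.within A` that meets `A` lies in `A`. -/
theorem ConnOn.subset_of_within {G : SimpleGraph V} {A S : Set V} (hS : (G.within A).ConnOn S)
    {x : V} (hx : x ∈ S) (hxA : x ∈ A) : S ⊆ A :=
  (hS (S ∩ A) Set.inter_subset_left ⟨x, hx, hxA⟩ fun _ _ _ hb hab => ⟨hb, hab.2.2⟩).trans
    Set.inter_subset_right

theorem within_le (G : SimpleGraph V) (A : Set V) : G.within A ≤ G := fun _ _ h => h.1

theorem within_mono (G : SimpleGraph V) {A B : Set V} (h : A ⊆ B) : G.within A ≤ G.within B :=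
  fun _ _ e => ⟨e.1, h e.2.1, h e.2.2⟩

/-- A separation of one side extends to a separation of the whole graph of the same order. -/
theorem IsSeparation.extend_left [Fintype V] {G : SimpleGraph V} {A B A' B' : Finset V}
    (h : G.IsSeparation A B) (h' : (G.within (A : Set V)).IsSeparation A' B')
    (hS : A ∩ B ⊆ B') :
    G.IsSeparation (A' ∩ A) (B' ∩ A ∪ B) ∧ (A' ∩ A) ∩ (B' ∩ A ∪ B) ⊆ A' ∩ B' := by
  refine ⟨⟨fun x => ?_, fun x y hxy => ?_⟩, fun x hx => ?_⟩
  · have := h.cover x; have := h'.cover x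
    simp only [Finset.mem_inter, Finset.mem_union]; tauto
  · have h1 := h.edge x y hxy
    have h2 : x ∈ A → y ∈ A → _ := fun hx hy => h'.edge x y ⟨hxy, hx, hy⟩
    simp only [Finset.mem_inter, Finset.mem_union]; tauto
  · have := @hS x
    simp only [Finset.mem_inter, Finset.mem_union] at *; tauto

theorem IsSeparation.symm {G : SimpleGraph V} {A B : Finset V} (h : G.IsSeparation A B) :
    G.IsSeparation B A :=
  ⟨fun x => (h.cover x).symm, fun x y e => (h.edge x y e).symm⟩

/-! ### Menger's theorem -/

/-- Set version of Menger's theorem: if no separation of order less than `|ι|` has all `X i` on one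
side and all `Y i` on the other, then disjoint connected sets match the `X i` with the `Y i`. -/
theorem menger [Fintype V] {ι : Type*} [Fintype ι] (n : ℕ) :
    ∀ (G : SimpleGraph V) (X Y : ι → V), X.Injective → Y.Injective →
      G.edgeFinset.card ≤ n →
      (∀ A B : Finset V, G.IsSeparation A B → (∀ i, X i ∈ A) → (∀ i, Y i ∈ B) →
        Fintype.card ι ≤ (A ∩ B).card) →
      ∃ (σ : Equiv.Perm ι) (P : ι → Set V), (∀ i j, i ≠ j → Disjoint (P i) (P j)) ∧
        (∀ i, G.ConnOn (P i)) ∧ (∀ i, X i ∈ P i) ∧ ∀ i, Y (σ i) ∈ P i := by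
  induction n with
  | zero =>
    intro G X Y hX hY hn hsep
    have hno : ∀ x y, ¬ G.Adj x y := by
      intro x y hxy
      have : s(x, y) ∈ G.edgeFinset := by simpa using hxy
      rw [Finset.card_eq_zero.1 (Nat.le_zero.1 hn)] at this
      simp at this
    -- Without edges every cover is a separation. The separator of this one is the intersection of
    -- the two ranges, so the ranges of `X` and `Y` coincide.
    have h1 := hsep (Finset.univ.image X) ((Finset.univ.image X)ᶜ ∪ Finset.univ.image Y)
      ⟨fun x => by simp only [Finset.mem_union, Finset.mem_compl]; tauto,
        fun x y h => (hno x y h).elim⟩ (by simp) (by simp)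
    have h2 : Finset.univ.image X ⊆ Finset.univ.image Y := by
      have hc : (Finset.univ.image X).card = Fintype.card ι := by
        rw [Finset.card_image_of_injective _ hX, Finset.card_univ]
      have := Finset.eq_of_subset_of_card_le
        (s := Finset.univ.image X ∩ ((Finset.univ.image X)ᶜ ∪ Finset.univ.image Y))
        Finset.inter_subset_left (by rw [hc]; exact h1)
      intro x hx
      have hx' := hx
      rw [← this] at hx'
      simp only [Finset.mem_inter, Finset.mem_union, Finset.mem_compl] at hx'
      tauto
    have h3 : ∀ i, ∃ j, Y j = X i := fun i => by
      have := h2 (Finset.mem_image_of_mem X (Finset.mem_univ i))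
      simpa using this
    choose f hf using h3
    have hfi : f.Injective := fun i j hij => hX (by rw [← hf i, ← hf j, hij])
    refine ⟨Equiv.ofBijective f (Finite.injective_iff_bijective.1 hfi), fun i => {X i}, ?_,
      fun i => connOn_singleton _ _, fun i => rfl, fun i => by simp [hf]⟩
    intro i j hij
    simpa using fun h => hij (hX h)
  | succ n ih =>
    intro G X Y hX hY hn hsep
    by_cases hle : G.edgeFinset.card ≤ n
    · exact ih G X Y hX hY hle hsep
    obtain ⟨e, he⟩ : G.edgeFinset.Nonempty := Finset.card_pos.1 (by omega)
    induction e with | _ x y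
    have hxy : G.Adj x y := by simpa using he
    obtain ⟨G', hG'⟩ : ∃ G', G' = G.deleteEdges {s(x, y)} := ⟨_, rfl⟩
    have hG'le : G' ≤ G := hG' ▸ G.deleteEdges_le _
    have hcard : ∀ H : SimpleGraph V, H ≤ G' → H.edgeFinset.card ≤ n := by
      intro H hH
      have : H.edgeFinset ⊂ G.edgeFinset := by
        refine (Finset.ssubset_iff_of_subset (edgeFinset_mono (hH.trans hG'le))).2 ⟨s(x, y), he, ?_⟩
        intro h
        have : H.Adj x y := by simpa using h
        have := hH this
        simp [hG'] at this
      have := Finset.card_lt_card this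
      omega
    by_cases hs : ∀ A B : Finset V, G'.IsSeparation A B → (∀ i, X i ∈ A) → (∀ i, Y i ∈ B) →
        Fintype.card ι ≤ (A ∩ B).card
    · obtain ⟨σ, P, h1, h2, h3, h4⟩ := ih G' X Y hX hY (hcard _ le_rfl) hs
      exact ⟨σ, P, h1, fun i => (h2 i).mono hG'le, h3, h4⟩
    push Not at hs
    obtain ⟨A, B, hAB, hXA, hYB, hlt⟩ := hs
    -- the two ends of the deleted edge lie strictly on different sides
    have main : ∀ x y, G.Adj x y → G' = G.deleteEdges {s(x, y)} → x ∈ A → x ∉ B → y ∈ B → y ∉ A →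
        ∃ (σ : Equiv.Perm ι) (P : ι → Set V), (∀ i j, i ≠ j → Disjoint (P i) (P j)) ∧
        (∀ i, G.ConnOn (P i)) ∧ (∀ i, X i ∈ P i) ∧ ∀ i, Y (σ i) ∈ P i := by
      clear hxy he hG' x y
      intro x y hxy hG' hxA hxB hyB hyA
      have hadj : ∀ a b, G.Adj a b → G'.Adj a b ∨ (a = x ∧ b = y) ∨ (a = y ∧ b = x) := by
        intro a b hab
        simp only [hG', deleteEdges_adj, Set.mem_singleton_iff, Sym2.eq_iff]
        tauto
      have hsepx : G.IsSeparation A (insert x B) := by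
        refine ⟨fun v => ?_, fun a b hab => ?_⟩
        · have := hAB.cover v
          simp only [Finset.mem_insert]; tauto
        · rcases hadj a b hab with h | ⟨rfl, rfl⟩ | ⟨rfl, rfl⟩
          · have := hAB.edge a b h
            simp only [Finset.mem_insert]; tauto
          · simp [hyB]
          · simp [hyB]
      have hsepy : G.IsSeparation (insert y A) B := by
        refine ⟨fun v => ?_, fun a b hab => ?_⟩
        · have := hAB.cover v
          simp only [Finset.mem_insert]; tauto
        · rcases hadj a b hab with h | ⟨rfl, rfl⟩ | ⟨rfl, rfl⟩
          · have := hAB.edge a b h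
            simp only [Finset.mem_insert]; tauto
          · simp [hxA]
          · simp [hxA]
      have hSx : A ∩ insert x B = insert x (A ∩ B) := by
        ext v; simp only [Finset.mem_inter, Finset.mem_insert]
        constructor
        · tauto
        · rintro (rfl | h) <;> tauto
      have hcx : (A ∩ insert x B).card = Fintype.card ι := by
        have h1 := hsep _ _ hsepx hXA (fun i => by simp [hYB i])
        have h2 : (A ∩ insert x B).card ≤ (A ∩ B).card + 1 := by
          rw [hSx]; exact Finset.card_insert_le _ _
        omega
      -- enumerate the two separators compatibly
      obtain ⟨f⟩ : Nonempty (ι ≃ (A ∩ insert x B : Finset V)) :=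
        Fintype.card_eq.1 (by rw [Fintype.card_coe]; exact hcx.symm)
      let s : ι → V := fun i => f i
      have hs : s.Injective := fun i j h => f.injective (Subtype.ext h)
      have hsmem : ∀ i, s i ∈ A ∩ insert x B := fun i => (f i).2
      have hssurj : ∀ v ∈ A ∩ insert x B, ∃ i, s i = v := fun v hv =>
        ⟨f.symm ⟨v, hv⟩, by simp [s]⟩
      -- The same enumeration with `x` replaced by `y`: a set ending at `x` on the left and one
      -- starting at `y` on the right are joined by the edge `xy`.
      let s' : ι → V := fun i => if s i = x then y else s i
      have hs'cases : ∀ i, (s i = x ∧ s' i = y) ∨ (s i ≠ x ∧ s' i = s i ∧ s i ∈ A ∧ s i ∈ B) := by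
        intro i
        have := hsmem i
        simp only [Finset.mem_inter, Finset.mem_insert] at this
        by_cases h : s i = x
        · exact .inl ⟨h, by simp [s', h]⟩
        · exact .inr ⟨h, by simp [s', h], this.1, this.2.resolve_left h⟩
      have hs' : s'.Injective := by
        intro i j hij
        rcases hs'cases i with ⟨h1, h2⟩ | ⟨h1, h2, h3, h4⟩ <;>
          rcases hs'cases j with ⟨k1, k2⟩ | ⟨k1, k2, k3, k4⟩
        · exact hs (h1.trans k1.symm)
        · rw [h2, k2] at hij; exact absurd (hij ▸ k3) hyA
        · rw [h2, k2] at hij; exact absurd (hij ▸ h3) hyA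
        · exact hs (by rw [← h2, ← k2, hij])
      have hs'B : ∀ i, s' i ∈ B := by
        intro i
        rcases hs'cases i with ⟨h1, h2⟩ | ⟨h1, h2, h3, h4⟩
        · rw [h2]; exact hyB
        · rw [h2]; exact h4
      have hsub : ∀ v ∈ A, v ∈ B → ∃ i, s i = v ∧ s' i = v := by
        intro v hv hv'
        obtain ⟨i, hi⟩ := hssurj v (by simp [hv, hv'])
        refine ⟨i, hi, ?_⟩
        have : v ≠ x := fun h => hxB (h ▸ hv')
        simp [s', hi, this]
      have hwA : G.within (A : Set V) ≤ G' := by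
        intro a b hab
        rcases hadj a b hab.1 with h | ⟨rfl, rfl⟩ | ⟨rfl, rfl⟩
        exacts [h, (hyA hab.2.2).elim, (hyA hab.2.1).elim]
      have hwB : G.within (B : Set V) ≤ G' := by
        intro a b hab
        rcases hadj a b hab.1 with h | ⟨rfl, rfl⟩ | ⟨rfl, rfl⟩
        exacts [h, (hxB hab.2.1).elim, (hxB hab.2.2).elim]
      -- A small separation inside `A` would extend, by adding the other side, to one of `G` that
      -- separates `X` from `Y`. The same holds inside `B`.
      obtain ⟨σ, P, P1, P2, P3, P4⟩ := ih (G.within (A : Set V)) X s hX hs (hcard _ hwA) (by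
        intro A' B' h' hXA' hsB'
        obtain ⟨h1, h2⟩ := hsepx.extend_left h' (fun v hv => by
          obtain ⟨i, rfl⟩ := hssurj v hv; exact hsB' i)
        refine (hsep _ _ h1 (fun i => by simp [hXA' i, hXA i]) (fun i => by simp [hYB i])).trans
          (Finset.card_le_card h2))
      obtain ⟨τ, Q, Q1, Q2, Q3, Q4⟩ := ih (G.within (B : Set V)) s' Y hs' hY (hcard _ hwB) (by
        intro A' B' h' hsA' hYB'
        obtain ⟨h1, h2⟩ := hsepy.symm.extend_left h'.symm (fun v hv => by
          simp only [Finset.mem_inter, Finset.mem_insert] at hv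
          rcases hv with ⟨hv, rfl | hv'⟩
          · obtain ⟨i, hi⟩ := hssurj x (by simp [hxA])
            have := hsA' i
            simpa [s', hi] using this
          · obtain ⟨i, -, hi⟩ := hsub v hv' hv
            exact hi ▸ hsA' i)
        refine (hsep _ _ h1.symm (fun i => by simp [hXA i]) (fun i => by simp [hYB' i, hYB i])).trans
          (Finset.card_le_card ((Finset.inter_comm _ _).subset.trans
            (h2.trans (Finset.inter_comm _ _).subset))))
      have hPA : ∀ i, P i ⊆ A := fun i => (P2 i).subset_of_within (P3 i) (by simpa using hXA i)
      have hQB : ∀ i, Q i ⊆ B := fun i => (Q2 i).subset_of_within (Q3 i) (by simpa using hs'B i)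
      -- A common vertex lies in `A ∩ B`, hence is an entry of both `s` and `s'` with the same
      -- index, and that index determines both sets.
      have hPQ : ∀ i j, i ≠ j → Disjoint (P i) (Q (σ j)) := by
        intro i j hij
        rw [Set.disjoint_left]
        intro v hv hv'
        obtain ⟨m, hm, hm'⟩ := hsub v (hPA i hv) (hQB _ hv')
        have e1 : i = σ.symm m := by
          by_contra h
          refine Set.disjoint_left.1 (P1 _ _ h) hv ?_
          have := P4 (σ.symm m)
          rwa [Equiv.apply_symm_apply, hm] at this
        have e2 : m = σ j := by
          by_contra h
          exact Set.disjoint_left.1 (Q1 _ _ h) (hm' ▸ Q3 m) hv'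
        exact hij (by rw [e1, e2, Equiv.symm_apply_apply])
      refine ⟨σ.trans τ, fun i => P i ∪ Q (σ i), ?_, ?_, fun i => .inl (P3 i), fun i => .inr (Q4 _)⟩
      · intro i j hij
        rw [Set.disjoint_union_left, Set.disjoint_union_right, Set.disjoint_union_right]
        exact ⟨⟨P1 i j hij, hPQ i j hij⟩, (hPQ j i hij.symm).symm,
          Q1 _ _ (fun h => hij (σ.injective h))⟩
      · intro i
        refine ((P2 i).mono (within_le _ _)).union ((Q2 _).mono (within_le _ _)) (P4 i) (Q3 _) ?_
        rcases hs'cases (σ i) with ⟨h1, h2⟩ | ⟨h1, h2, h3, h4⟩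
        · rw [h1, h2]; exact .inr hxy
        · exact .inl h2.symm
    -- Restoring the edge must destroy the separation, which forces its ends to lie strictly on
    -- opposite sides.
    have hnot : ¬ G.IsSeparation A B := fun h => absurd (hsep A B h hXA hYB) (by omega)
    by_cases h1 : x ∈ A ∧ x ∉ B ∧ y ∈ B ∧ y ∉ A
    · exact main x y hxy hG' h1.1 h1.2.1 h1.2.2.1 h1.2.2.2
    by_cases h2 : y ∈ A ∧ y ∉ B ∧ x ∈ B ∧ x ∉ A
    · exact main y x hxy.symm (by rw [hG', Sym2.eq_swap]) h2.1 h2.2.1 h2.2.2.1 h2.2.2.2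
    refine (hnot ⟨hAB.cover, fun a b hab => ?_⟩).elim
    by_cases hab' : G'.Adj a b
    · exact hAB.edge a b hab'
    · have : s(a, b) = s(x, y) := by
        simp only [hG', deleteEdges_adj, Set.mem_singleton_iff] at hab'
        tauto
      have c1 := hAB.cover x
      have c2 := hAB.cover y
      rcases Sym2.eq_iff.1 this with ⟨rfl, rfl⟩ | ⟨rfl, rfl⟩ <;> tauto

/-! ### Clique models, attached terminals and the rigid case -/

/-- The sets `B k` are the branch sets of a complete minor of `G`. -/
structure IsCliqueModel {κ : Type*} (G : SimpleGraph V) (B : κ → Set V) : Prop where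
  nonempty : ∀ k, (B k).Nonempty
  conn : ∀ k, G.ConnOn (B k)
  disj : ∀ k m, k ≠ m → Disjoint (B k) (B m)
  adj : ∀ k m, k ≠ m → ∃ x ∈ B k, ∃ y ∈ B m, G.Adj x y

theorem IsCliqueModel.eq_of_mem {κ : Type*} {G : SimpleGraph V} {B : κ → Set V}
    (h : G.IsCliqueModel B) {k m : κ} {x : V} (hk : x ∈ B k) (hm : x ∈ B m) : k = m := by
  by_contra hne
  exact Set.disjoint_left.1 (h.disj k m hne) hk hm

/-- `G` together with all edges inside `Z`. -/
def completeOn (G : SimpleGraph V) (Z : Set V) : SimpleGraph V where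
  Adj x y := x ≠ y ∧ (G.Adj x y ∨ (x ∈ Z ∧ y ∈ Z))
  symm := ⟨fun _ _ h => ⟨h.1.symm, h.2.imp SimpleGraph.Adj.symm And.symm⟩⟩
  loopless := ⟨fun _ h => h.1 rfl⟩

/-- The image of `G` under `φ`, without the edges inside `Z`. -/
def imageOff (G : SimpleGraph V) (φ : V → V) (Z : Set V) : SimpleGraph V where
  Adj x y := x ≠ y ∧ ¬ (x ∈ Z ∧ y ∈ Z) ∧ ∃ a b, φ a = x ∧ φ b = y ∧ G.Adj a b
  symm := ⟨fun _ _ h => ⟨h.1.symm, fun k => h.2.1 k.symm,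
    let ⟨a, b, ha, hb, hab⟩ := h.2.2; ⟨b, a, hb, ha, hab.symm⟩⟩⟩
  loopless := ⟨fun _ h => h.1 rfl⟩

/-- Every separation of `G` with the terminals `z` on the left and some branch set strictly on the
right has order at least the number of terminals. -/
def WellAttached {ι κ : Type*} [Fintype ι] (G : SimpleGraph V) (z : ι → V) (B : κ → Set V) : Prop :=
  ∀ S T : Finset V, G.IsSeparation S T → (∀ i, z i ∈ S) → (∃ k, Disjoint (B k) (S : Set V)) →
    Fintype.card ι ≤ (S ∩ T).card

/-- Disjoint connected sets that collect the terminals according to the labels `c`. -/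
def Linked {ι L : Type*} (G : SimpleGraph V) (z : ι → V) (c : ι → L) : Prop :=
  ∃ P : L → Set V, (∀ l m, l ≠ m → Disjoint (P l) (P m)) ∧ (∀ l, G.ConnOn (P l)) ∧
    ∀ i, z i ∈ P (c i)

/-- The number of vertices that are not isolated. -/
noncomputable def supportCard [Fintype V] (G : SimpleGraph V) : ℕ :=
  (Finset.univ.filter fun x => ∃ y, G.Adj x y).card

/-- Branch sets are disjoint, so each terminal spoils at most one of them. -/
theorem card_free_le {ι κ : Type*} [Fintype ι] [Fintype κ]
    {G : SimpleGraph V} {z : ι → V} {B : κ → Set V} (hB : G.IsCliqueModel B)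
    (hcard : 2 * Fintype.card ι ≤ Fintype.card κ) :
    Fintype.card ι ≤ (Finset.univ.filter fun k => Disjoint (B k) (Set.range z)).card := by
  have h1 : (Finset.univ.filter fun k => ¬ Disjoint (B k) (Set.range z)).card ≤
      Fintype.card ι := by
    rcases isEmpty_or_nonempty ι with hι | hι
    · simp [Set.range_eq_empty]
    have : ∀ k ∈ Finset.univ.filter fun k => ¬ Disjoint (B k) (Set.range z), ∃ i, z i ∈ B k := by
      intro k hk
      obtain ⟨x, hx, i, rfl⟩ := Set.not_disjoint_iff.1 (Finset.mem_filter.1 hk).2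
      exact ⟨i, hx⟩
    choose! f hf using this
    rw [← Finset.card_univ]
    refine Finset.card_le_card_of_injOn f (fun _ _ => Finset.mem_coe.2 (Finset.mem_univ _)) ?_
    intro k hk m hm hkm
    exact hB.eq_of_mem (hf k hk) (by rw [hkm]; exact hf m hm)
  have h2 := Finset.card_filter_add_card_filter_not (s := Finset.univ)
    (fun k => Disjoint (B k) (Set.range z))
  rw [Finset.card_univ] at h2
  omega

/-- The base case of the linkage lemma: no edge at a non-terminal is left to contract. A branch set
with a non-terminal is then a single vertex, so all neighbours of terminals are pairwise adjacent.
Hall's theorem gives the terminals distinct neighbours, and any labelling is realised through these.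
-/
theorem linked_of_rigid [Fintype V] {ι κ L : Type*} [Fintype ι] [Fintype κ]
    {G : SimpleGraph V} {z : ι → V} {B : κ → Set V} (c : ι → L) (hz : z.Injective)
    (hzz : ∀ i j, ¬ G.Adj (z i) (z j)) (hB : (G.completeOn (Set.range z)).IsCliqueModel B)
    (hcard : 2 * Fintype.card ι ≤ Fintype.card κ) (hatt : G.WellAttached z B)
    (hrig : ∀ u v, G.Adj u v → v ∉ Set.range z → ∃ k m, k ≠ m ∧ u ∈ B k ∧ v ∈ B m) :
    G.Linked z c := by
  set Z := Set.range z with hZ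
  have hsing : ∀ m x, x ∈ B m → x ∉ Z → ∀ y ∈ B m, y = x := by
    intro m x hx hxZ
    have := hB.conn m {x} (by simpa using hx) ⟨x, rfl⟩ ?_
    · exact fun y hy => this hy
    · rintro a rfl y hy hay
      rcases hay.2 with h | h
      · obtain ⟨k, m', hkm, hk, hm⟩ := hrig y a h.symm hxZ
        exact (hkm ((hB.eq_of_mem hk hy).trans (hB.eq_of_mem hx hm))).elim
      · exact (hxZ h.1).elim
  have hfree := card_free_le (z := z) hB hcard
  set F := Finset.univ.filter fun k => Disjoint (B k) (Set.range z) with hF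
  choose b hb using hB.nonempty
  have hbZ : ∀ k ∈ F, b k ∉ Z := fun k hk h =>
    Set.disjoint_left.1 (Finset.mem_filter.1 hk).2 (hb k) h
  have hnbr : ∀ x y, G.Adj y x → x ∉ Z → ∃ k ∈ F, x = b k := by
    intro x y hyx hx
    obtain ⟨-, m, -, -, hm⟩ := hrig y x hyx hx
    refine ⟨m, ?_, (hsing m x hm hx _ (hb m)).symm⟩
    rw [hF, Finset.mem_filter, Set.disjoint_left]
    refine ⟨Finset.mem_univ _, fun w hw hwZ => hx ?_⟩
    rwa [← hsing m x hm hx w hw]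
  have hnZ : ∀ i x, G.Adj (z i) x → x ∉ Z := by
    rintro i x h ⟨j, rfl⟩
    exact hzz i j h
  -- If a set `s` of terminals violates Hall's condition, its neighbourhood `N` together with the
  -- terminals outside `s` is a separator with fewer than `|ι|` vertices. Since `N` is small, it
  -- misses some terminal-free branch set, which lies strictly on the right: a contradiction.
  obtain ⟨f, hfi, hf⟩ := (Finset.all_card_le_biUnion_card_iff_exists_injective
      (fun i => Finset.univ.filter fun x => G.Adj (z i) x)).1 (by
    intro s
    set N := s.biUnion fun i => Finset.univ.filter fun x => G.Adj (z i) x with hN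
    by_contra! hlt
    have hmem : ∀ x, x ∈ N ↔ ∃ i ∈ s, G.Adj (z i) x := by simp [hN]
    have hsle : s.card ≤ Fintype.card ι := Finset.card_le_univ _
    obtain ⟨k, hk, hkN⟩ : ∃ k ∈ F, b k ∉ N := by
      by_contra! hall
      have := Finset.card_le_card_of_injOn b hall (fun k _ m _ hkm =>
        hB.eq_of_mem (hb k) (by rw [hkm]; exact hb m))
      omega
    have h1 := hatt (Finset.univ.image z ∪ N) (s.image z)ᶜ ⟨fun x => ?_, fun x y hxy => ?_⟩
      (by simp) ⟨k, ?_⟩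
    · have h2 : (Finset.univ.image z ∪ N) ∩ (s.image z)ᶜ ⊆ sᶜ.image z ∪ N := by
        intro x hx
        simp only [Finset.mem_inter, Finset.mem_union, Finset.mem_compl, Finset.mem_image,
          Finset.mem_univ, true_and] at hx ⊢
        rcases hx with ⟨⟨i, rfl⟩ | h, h'⟩
        · exact .inl ⟨i, fun hi => h' ⟨i, hi, rfl⟩, rfl⟩
        · exact .inr h
      have h3 := (Finset.card_le_card h2).trans (Finset.card_union_le _ _)
      rw [Finset.card_image_of_injective _ hz, Finset.card_compl] at h3
      omega
    · by_cases hx : x ∈ s.image z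
      · obtain ⟨i, -, rfl⟩ := Finset.mem_image.1 hx
        simp
      · simp only [Finset.mem_compl]; tauto
    · have key : ∀ x y, G.Adj x y → x ∈ s.image z → y ∈ N := by
        intro x y hxy hx
        obtain ⟨i, hi, rfl⟩ := Finset.mem_image.1 hx
        exact (hmem y).2 ⟨i, hi, hxy⟩
      have k1 := key x y hxy
      have k2 := key y x hxy.symm
      have k3 : ∀ x, x ∈ s.image z → x ∈ Finset.univ.image z :=
        fun x hx => Finset.image_subset_image (Finset.subset_univ s) hx
      have := k3 x; have := k3 y
      simp only [Finset.mem_union, Finset.mem_compl]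
      tauto
    · rw [Set.disjoint_left]
      intro x hx hx'
      have hxb := hsing k (b k) (hb k) (hbZ k hk) x hx
      subst hxb
      simp only [Finset.coe_union, Finset.coe_image, Finset.coe_univ, Set.image_univ, Set.mem_union,
        Finset.mem_coe] at hx'
      exact hx'.elim (hbZ k hk) hkN)
  have hf' : ∀ i, G.Adj (z i) (f i) := fun i => by simpa using hf i
  have hfZ : ∀ i, f i ∉ Z := fun i => hnZ i _ (hf' i)
  have hff : ∀ i j, i ≠ j → G.Adj (f i) (f j) := by
    intro i j hij
    obtain ⟨k, hk, hk'⟩ := hnbr _ _ (hf' i) (hfZ i)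
    obtain ⟨m, hm, hm'⟩ := hnbr _ _ (hf' j) (hfZ j)
    obtain ⟨x, hx, y, hy, hxy⟩ := hB.adj k m (fun h => hij (hfi (by rw [hk', hm', h])))
    have e1 := hsing k (b k) (hb k) (hbZ k hk) x hx
    have e2 := hsing m (b m) (hb m) (hbZ m hm) y hy
    rw [e1, e2, ← hk', ← hm'] at hxy
    exact hxy.2.resolve_right fun h => hfZ i h.1
  refine ⟨fun l => {x | ∃ i, c i = l ∧ (x = z i ∨ x = f i)}, ?_, ?_, fun i => ⟨i, rfl, .inl rfl⟩⟩
  · intro l m hlm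
    rw [Set.disjoint_left]
    rintro x ⟨i, rfl, hi⟩ ⟨j, rfl, hj⟩
    have hij : i ≠ j := fun h => hlm (by rw [h])
    rcases hi with rfl | rfl <;> rcases hj with hj | hj
    · exact hij (hz hj)
    · exact hfZ j (hj ▸ ⟨i, rfl⟩)
    · exact hfZ i (hj ▸ ⟨j, rfl⟩)
    · exact hij (hfi hj)
  · rintro l U hU ⟨x, hx⟩ hcl
    have h1 : ∃ i, c i = l ∧ f i ∈ U := by
      obtain ⟨i, hi, rfl | rfl⟩ := hU hx
      · exact ⟨i, hi, hcl _ hx _ ⟨i, hi, .inr rfl⟩ (hf' i)⟩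
      · exact ⟨i, hi, hx⟩
    obtain ⟨i, hi, hiU⟩ := h1
    have h2 : ∀ j, c j = l → f j ∈ U := by
      intro j hj
      by_cases h : i = j
      · exact h ▸ hiU
      · exact hcl _ hiU _ ⟨j, hj, .inr rfl⟩ (hff i j h)
    rintro y ⟨j, hj, rfl | rfl⟩
    · exact hcl _ (h2 j hj) _ ⟨j, hj, .inl rfl⟩ (hf' j).symm
    · exact h2 j hj

/-! ### Contracting an edge -/

section Contract

variable {ι κ L : Type*} {G : SimpleGraph V} {z : ι → V} {B : κ → Set V}
  {φ : V → V} {u v : V}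

/-- The only vertices identified are `u` and `v`, which do not lie in two different branch sets, so
the images stay disjoint. Edges between terminals lost in `imageOff` are supplied again by
`completeOn`. -/
theorem IsCliqueModel.image (hB : (G.completeOn (Set.range z)).IsCliqueModel B)
    (hφz : ∀ i, φ (z i) = z i) (hφ : ∀ a b, φ a = φ b → a = b ∨ (a = u ∧ b = v) ∨ (a = v ∧ b = u))
    (huv : ¬ ∃ k m, k ≠ m ∧ u ∈ B k ∧ v ∈ B m) :
    ((G.imageOff φ (Set.range z)).completeOn (Set.range z)).IsCliqueModel fun k => φ '' B k := by
  have hdis : ∀ k m, k ≠ m → ∀ a ∈ B k, ∀ b ∈ B m, φ a ≠ φ b := by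
    intro k m hkm a ha b hb hab
    rcases hφ a b hab with rfl | ⟨rfl, rfl⟩ | ⟨rfl, rfl⟩
    · exact hkm (hB.eq_of_mem ha hb)
    · exact huv ⟨k, m, hkm, ha, hb⟩
    · exact huv ⟨m, k, hkm.symm, hb, ha⟩
  have hadj : ∀ a b, (G.completeOn (Set.range z)).Adj a b → φ a ≠ φ b →
      ((G.imageOff φ (Set.range z)).completeOn (Set.range z)).Adj (φ a) (φ b) := by
    rintro a b ⟨-, h⟩ hne
    refine ⟨hne, ?_⟩
    rcases h with h | ⟨⟨i, rfl⟩, ⟨j, rfl⟩⟩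
    · by_cases hZ : φ a ∈ Set.range z ∧ φ b ∈ Set.range z
      · exact .inr hZ
      · exact .inl ⟨hne, hZ, a, b, rfl, rfl, h⟩
    · exact .inr ⟨⟨i, (hφz i).symm⟩, ⟨j, (hφz j).symm⟩⟩
  refine ⟨fun k => (hB.nonempty k).image _, fun k => ?_, fun k m hkm => ?_, fun k m hkm => ?_⟩
  · rintro U hU ⟨x, hx⟩ hcl
    obtain ⟨a, ha, rfl⟩ := hU hx
    have := hB.conn k {a | a ∈ B k ∧ φ a ∈ U} (fun _ h => h.1) ⟨a, ha, hx⟩ ?_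
    · rintro - ⟨b, hb, rfl⟩
      exact (this hb).2
    · rintro a ⟨ha, haU⟩ b hb hab
      refine ⟨hb, ?_⟩
      by_cases h : φ a = φ b
      · exact h ▸ haU
      · exact hcl _ haU _ ⟨b, hb, rfl⟩ (hadj a b hab h)
  · rw [Set.disjoint_left]
    rintro - ⟨a, ha, rfl⟩ ⟨b, hb, hab⟩
    exact hdis k m hkm a ha b hb hab.symm
  · obtain ⟨x, hx, y, hy, hxy⟩ := hB.adj k m hkm
    exact ⟨_, ⟨x, hx, rfl⟩, _, ⟨y, hy, rfl⟩, hadj x y hxy (hdis k m hkm x hx y hy)⟩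

/-- Linkages are pulled back along the contraction; preimages stay connected because the only
nontrivial fibre consists of the ends of the edge `uv`. -/
theorem Linked.of_image {c : ι → L} (h : (G.imageOff φ (Set.range z)).Linked z c)
    (huv : G.Adj u v) (hφz : ∀ i, φ (z i) = z i)
    (hφ : ∀ a b, φ a = φ b → a = b ∨ (a = u ∧ b = v) ∨ (a = v ∧ b = u)) : G.Linked z c := by
  obtain ⟨P, hP1, hP2, hP3⟩ := h
  refine ⟨fun l => φ ⁻¹' P l, fun l m hlm => (hP1 l m hlm).preimage φ, fun l => ?_, fun i => ?_⟩
  · rintro U hU ⟨x, hx⟩ hcl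
    have hsat : ∀ a b, φ a = φ b → a ∈ U → b ∈ U := by
      intro a b hab ha
      have hb : b ∈ φ ⁻¹' P l := by
        have := hU ha
        rwa [Set.mem_preimage, hab] at this
      rcases hφ a b hab with rfl | ⟨rfl, rfl⟩ | ⟨rfl, rfl⟩
      exacts [ha, hcl _ ha _ hb huv, hcl _ ha _ hb huv.symm]
    have := hP2 l (φ '' U) (by rintro - ⟨a, ha, rfl⟩; exact hU ha) ⟨φ x, x, hx, rfl⟩ ?_
    · intro y hy
      obtain ⟨a, ha, hay⟩ := this hy
      exact hsat a y hay ha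
    · rintro - ⟨a, ha, rfl⟩ y hy ⟨-, -, a', b', haa', rfl, hab⟩
      exact ⟨b', hcl a' (hsat a a' haa'.symm ha) b' hy hab, rfl⟩
  · rw [Set.mem_preimage, hφz i]
    exact hP3 i

theorem supportCard_imageOff_lt [Fintype V] (huv : G.Adj u v) (Z : Set V)
    (hφu : φ v = u) (hφ : ∀ a, a ≠ v → φ a = a) : (G.imageOff φ Z).supportCard < G.supportCard := by
  refine Finset.card_lt_card ((Finset.ssubset_iff_of_subset ?_).2 ⟨v, ?_, ?_⟩)
  · intro x hx
    simp only [Finset.mem_filter, Finset.mem_univ, true_and] at hx ⊢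
    obtain ⟨y, -, -, a, b, rfl, rfl, hab⟩ := hx
    by_cases ha : a = v
    · exact ⟨v, by rw [ha, hφu]; exact huv⟩
    · exact ⟨b, by rwa [hφ a ha]⟩
  · simpa using ⟨u, huv.symm⟩
  · simp only [Finset.mem_filter, Finset.mem_univ, true_and, not_exists]
    rintro y ⟨-, -, a, b, ha, -, -⟩
    by_cases h : a = v
    · rw [h, hφu] at ha; exact huv.ne ha
    · exact h (by rw [← hφ a h, ha])

/-- A separation of small order of the contracted graph comes from one of `G` whose separator holds
both ends of the contracted edge. -/
theorem exists_tight_separation [Fintype V] [Fintype ι] (hatt : G.WellAttached z B)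
    (hφ : ∀ a, a ≠ v → φ a = a) (hφz : ∀ i, φ (z i) = z i)
    (h : ¬ (G.imageOff φ (Set.range z)).WellAttached z fun k => φ '' B k) :
    ∃ S T : Finset V, G.IsSeparation S T ∧ (∀ i, z i ∈ S) ∧ (∃ k, Disjoint (B k) (S : Set V)) ∧
      (S ∩ T).card = Fintype.card ι ∧ v ∈ S ∩ T := by
  unfold WellAttached at h
  push Not at h
  obtain ⟨S, T, hST, hzS, ⟨k, hk⟩, hlt⟩ := h
  set S' := Finset.univ.filter fun x => φ x ∈ S with hS'
  set T' := Finset.univ.filter fun x => φ x ∈ T with hT'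
  have mS : ∀ x, x ∈ S' ↔ φ x ∈ S := by simp [hS']
  have mT : ∀ x, x ∈ T' ↔ φ x ∈ T := by simp [hT']
  have h1 : G.IsSeparation S' T' := by
    refine ⟨fun x => by rw [mS, mT]; exact hST.cover _, fun x y hxy => ?_⟩
    rw [mS, mS, mT, mT]
    by_cases he : φ x = φ y
    · rw [he]; have := hST.cover (φ y); tauto
    · by_cases hZ : φ x ∈ Set.range z ∧ φ y ∈ Set.range z
      · obtain ⟨⟨i, hi⟩, ⟨j, hj⟩⟩ := hZ
        exact .inl ⟨hi ▸ hzS i, hj ▸ hzS j⟩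
      · exact hST.edge _ _ ⟨he, hZ, x, y, rfl, rfl, hxy⟩
  have h2 : ∀ i, z i ∈ S' := fun i => by rw [mS, hφz]; exact hzS i
  have h3 : Disjoint (B k) (S' : Set V) := by
    rw [Set.disjoint_left] at hk ⊢
    intro x hx hx'
    exact hk ⟨x, hx, rfl⟩ (Finset.mem_coe.2 ((mS x).1 hx'))
  have h4 := hatt S' T' h1 h2 ⟨k, h3⟩
  have h5 : S' ∩ T' ⊆ insert v (S ∩ T) := by
    intro x hx
    rw [Finset.mem_inter, mS, mT] at hx
    by_cases hxv : x = v
    · simp [hxv]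
    · rw [hφ x hxv] at hx
      simp [hx]
  -- Pulling back adds at most `v` to the separator, while `hatt` demands at least `|ι|` vertices.
  -- Hence `v` is really added and the order is exactly `|ι|`.
  have hv : v ∈ S' ∩ T' := by
    by_contra hv
    have h6 : S' ∩ T' ⊆ S ∩ T := fun x hx =>
      (Finset.mem_insert.1 (h5 hx)).resolve_left fun h => hv (h ▸ hx)
    have := Finset.card_le_card h6
    omega
  have h7 := (Finset.card_le_card h5).trans (Finset.card_insert_le _ _)
  exact ⟨S', T', h1, h2, ⟨k, h3⟩, by omega, hv⟩

end Contract

/-! ### Passing to the far side of a tight separation -/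

section Tight

variable {ι κ L : Type*} {G : SimpleGraph V} {z t : ι → V} {B : κ → Set V} {S T : Finset V}

/-- The right-hand side of a separation, with the separator as new terminal set. -/
theorem IsCliqueModel.restrict (hB : (G.completeOn (Set.range z)).IsCliqueModel B)
    (hST : G.IsSeparation S T) (hzS : ∀ i, z i ∈ S) {k₀ : κ} (hk₀ : Disjoint (B k₀) (S : Set V))
    (ht : Set.range t = (S ∩ T : Finset V)) :
    (((G.within (T : Set V)).imageOff id (Set.range t)).completeOn (Set.range t)).IsCliqueModel
      fun k => B k ∩ T := by
  have mt : ∀ x, x ∈ Set.range t ↔ x ∈ S ∧ x ∈ T := fun x => by rw [ht]; simp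
  have hadjT : ∀ x y, (G.completeOn (Set.range z)).Adj x y → x ∈ T → y ∈ T →
      (((G.within (T : Set V)).imageOff id (Set.range t)).completeOn (Set.range t)).Adj x y := by
    rintro x y ⟨hne, h⟩ hx hy
    refine ⟨hne, ?_⟩
    by_cases hs : x ∈ Set.range t ∧ y ∈ Set.range t
    · exact .inr hs
    · refine .inl ⟨hne, hs, x, y, rfl, rfl, ?_, hx, hy⟩
      refine h.resolve_right ?_
      rintro ⟨⟨i, rfl⟩, ⟨j, rfl⟩⟩
      exact hs ⟨(mt _).2 ⟨hzS i, hx⟩, (mt _).2 ⟨hzS j, hy⟩⟩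
  have hcross : ∀ x y, (G.completeOn (Set.range z)).Adj x y → x ∉ S → y ∈ T := by
    rintro x y ⟨-, h | ⟨⟨i, rfl⟩, -⟩⟩ hx
    · exact ((hST.edge x y h).resolve_left fun h => hx h.1).2
    · exact (hx (hzS i)).elim
  have hmem : ∀ x, x ∉ S → x ∈ T := fun x hx => (hST.cover x).resolve_left hx
  have hne : ∀ k, (B k ∩ (T : Set V)).Nonempty := by
    intro k
    by_cases hk : k = k₀
    · subst hk
      obtain ⟨x, hx⟩ := hB.nonempty k
      exact ⟨x, hx, hmem x fun h => Set.disjoint_left.1 hk₀ hx h⟩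
    · obtain ⟨x, hx, y, hy, hxy⟩ := hB.adj k₀ k (Ne.symm hk)
      exact ⟨y, hy, hcross x y hxy fun h => Set.disjoint_left.1 hk₀ hx h⟩
  -- a branch set reaching outside `T` meets the separator
  have hmeet : ∀ k, (∃ x ∈ B k, x ∉ T) → ∃ y ∈ B k, y ∈ Set.range t := by
    rintro k ⟨x, hx, hxT⟩
    by_contra! hno
    have := hB.conn k (B k ∩ (T : Set V)) Set.inter_subset_left (hne k) ?_ hx
    · exact hxT this.2
    · rintro a ⟨ha, haT⟩ b hb hab
      exact ⟨hb, hcross a b hab fun haS => hno a ha ((mt a).2 ⟨haS, haT⟩)⟩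
  refine ⟨hne, fun k => ?_, fun k m hkm => ?_, fun k m hkm => ?_⟩
  · rintro U hU ⟨u, hu⟩ hcl
    by_cases hs : ∃ s ∈ U, s ∈ Set.range t
    · obtain ⟨s, hsU, hs⟩ := hs
      have hall : ∀ y ∈ B k, y ∈ Set.range t → y ∈ U := by
        intro y hy hyt
        by_cases h : s = y
        · exact h ▸ hsU
        · exact hcl s hsU y ⟨hy, ((mt y).1 hyt).2⟩ ⟨h, .inr ⟨hs, hyt⟩⟩
      -- Once `U` holds one separator vertex it holds all those of `B k`, by the virtual clique on
      -- the separator, so adding the part of `B k` outside `T` keeps it closed.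
      have := hB.conn k (U ∪ (B k \ T)) (Set.union_subset (fun x hx => (hU hx).1)
        Set.sdiff_subset) ⟨u, .inl hu⟩ ?_
      · rintro x ⟨hx, hxT⟩
        exact (this hx).resolve_right fun h => h.2 hxT
      · intro a ha b hb hab
        by_cases hbT : b ∈ T
        · left
          by_cases hbS : b ∈ S
          · exact hall b hb ((mt b).2 ⟨hbS, hbT⟩)
          · have haT : a ∈ T := hcross b a hab.symm hbS
            exact hcl a (ha.resolve_right fun h => h.2 haT) b ⟨hb, hbT⟩ (hadjT a b hab haT hbT)
        · exact .inr ⟨hb, hbT⟩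
    · push Not at hs
      have := hB.conn k U (fun x hx => (hU hx).1) ⟨u, hu⟩ ?_
      · exact fun x hx => this hx.1
      · intro a ha b hb hab
        have haT := (hU ha).2
        have hbT : b ∈ T := hcross a b hab fun h => hs a ha ((mt a).2 ⟨h, haT⟩)
        exact hcl a ha b ⟨hb, hbT⟩ (hadjT a b hab haT hbT)
  · exact (hB.disj k m hkm).mono Set.inter_subset_left Set.inter_subset_left
  · by_cases hout : (∃ y ∈ B k, y ∈ Set.range t) ∧ ∃ y ∈ B m, y ∈ Set.range t
    · obtain ⟨⟨x, hx, hxt⟩, y, hy, hyt⟩ := hout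
      refine ⟨x, ⟨hx, ((mt x).1 hxt).2⟩, y, ⟨hy, ((mt y).1 hyt).2⟩, ?_, .inr ⟨hxt, hyt⟩⟩
      rintro rfl
      exact hkm (hB.eq_of_mem hx hy)
    · obtain ⟨x, hx, y, hy, hxy⟩ := hB.adj k m hkm
      have hxT : x ∈ T := by
        by_contra hxT
        have hyS : y ∈ S := by
          by_contra h
          exact hxT (hcross y x hxy.symm h)
        refine hout ⟨hmeet k ⟨x, hx, hxT⟩, ?_⟩
        by_cases hyT : y ∈ T
        · exact ⟨y, hy, (mt y).2 ⟨hyS, hyT⟩⟩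
        · exact hmeet m ⟨y, hy, hyT⟩
      have hyT : y ∈ T := by
        by_contra hyT
        have hxS : x ∈ S := by
          by_contra h
          exact hyT (hcross x y hxy h)
        exact hout ⟨⟨x, hx, (mt x).2 ⟨hxS, hxT⟩⟩, hmeet m ⟨y, hy, hyT⟩⟩
      exact ⟨x, ⟨hx, hxT⟩, y, ⟨hy, hyT⟩, hadjT x y hxy hxT hyT⟩

/-- Adding all of `S` to the left of a separation of the far side gives a separation of `G` whose
separator is no larger. A branch set whose trace on `T` avoids the left side also avoids `S`, so
well-attachedness of `G` applies. -/
theorem WellAttached.restrict [Fintype V] [Fintype ι]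
    (hB : (G.completeOn (Set.range z)).IsCliqueModel B) (hatt : G.WellAttached z B)
    (hST : G.IsSeparation S T) (hzS : ∀ i, z i ∈ S) {k₀ : κ} (hk₀ : Disjoint (B k₀) (S : Set V))
    (ht : Set.range t = (S ∩ T : Finset V)) :
    ((G.within (T : Set V)).imageOff id (Set.range t)).WellAttached t fun k => B k ∩ T := by
  have mt : ∀ x, x ∈ Set.range t ↔ x ∈ S ∧ x ∈ T := fun x => by rw [ht]; simp
  rintro S' T' h' htS' ⟨k, hk⟩
  have hSS' : ∀ x, x ∈ S → x ∈ T → x ∈ S' := by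
    intro x hx hxT
    obtain ⟨i, rfl⟩ := (mt x).2 ⟨hx, hxT⟩
    exact htS' i
  have hT : (G.within (T : Set V)).IsSeparation T' S' := by
    refine ⟨fun x => (h'.cover x).symm, fun x y hxy => ?_⟩
    by_cases hs : x ∈ Set.range t ∧ y ∈ Set.range t
    · obtain ⟨⟨i, rfl⟩, ⟨j, rfl⟩⟩ := hs
      exact .inr ⟨htS' i, htS' j⟩
    · exact (h'.edge x y ⟨hxy.ne, hs, x, y, rfl, rfl, hxy⟩).symm
  obtain ⟨h1, h2⟩ := hST.symm.extend_left hT (fun x hx => by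
    rw [Finset.mem_inter] at hx; exact hSS' x hx.2 hx.1)
  refine (hatt _ _ h1.symm (fun i => Finset.mem_union_right _ (hzS i)) ⟨k, ?_⟩).trans ?_
  · -- the branch set lies strictly inside `T`
    have hin : B k ⊆ {x | x ∉ S} := by
      obtain ⟨x, hx, hxT⟩ := (hB.restrict hST hzS hk₀ ht).nonempty k
      have hnt : ∀ y ∈ B k, y ∈ T → y ∉ S := fun y hy hyT hyS =>
        Set.disjoint_left.1 hk ⟨hy, hyT⟩ (hSS' y hyS hyT)
      have := hB.conn k {y | y ∈ B k ∧ y ∉ S} (fun _ h => h.1) ⟨x, hx, hnt x hx hxT⟩ ?_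
      · exact fun y hy => (this hy).2
      · rintro a ⟨ha, haS⟩ b hb ⟨-, h | ⟨⟨i, rfl⟩, -⟩⟩
        · exact ⟨hb, hnt b hb ((hST.edge a b h).resolve_left fun h => haS h.1).2⟩
        · exact (haS (hzS i)).elim
    rw [Set.disjoint_left]
    intro x hx hx'
    have hxS := hin hx
    have hxT : x ∈ T := (hST.cover x).resolve_left hxS
    simp only [Finset.coe_union, Finset.coe_inter, Set.mem_union, Set.mem_inter_iff,
      Finset.mem_coe] at hx'
    rcases hx' with ⟨h, -⟩ | h
    exacts [Set.disjoint_left.1 hk ⟨hx, hxT⟩ h, hxS h]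
  · rw [Finset.inter_comm S' T']
    rw [Finset.inter_comm]
    exact Finset.card_le_card h2

/-- The sets `M i` carry the terminals across `S` to the separator, and the linkage of the far side
continues them under the transported labels. The two families meet only in the separator, where the
labels agree. -/
theorem Linked.of_restrict {σ : Equiv.Perm ι} {c : ι → L} {M : ι → Set V}
    (h : ((G.within (T : Set V)).imageOff id (Set.range t)).Linked t (c ∘ σ.symm))
    (hzS : ∀ i, z i ∈ S) (ht : Set.range t = (S ∩ T : Finset V))
    (hM1 : ∀ i j, i ≠ j → Disjoint (M i) (M j)) (hM2 : ∀ i, (G.within (S : Set V)).ConnOn (M i))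
    (hM3 : ∀ i, z i ∈ M i) (hM4 : ∀ i, t (σ i) ∈ M i) : G.Linked z c := by
  obtain ⟨P, hP1, hP2, hP3⟩ := h
  have mt : ∀ x, x ∈ Set.range t ↔ x ∈ S ∧ x ∈ T := fun x => by rw [ht]; simp
  have hMS : ∀ i, M i ⊆ S := fun i => (hM2 i).subset_of_within (hM3 i) (hzS i)
  have hle : (G.within (T : Set V)).imageOff id (Set.range t) ≤ G := by
    rintro x y ⟨-, -, a, b, rfl, rfl, hab⟩
    exact hab.1
  -- drop the sets without terminals
  let P' : L → Set V := fun l => {x | x ∈ P l ∧ ∃ i, c i = l}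
  have hP'T : ∀ l, P' l ⊆ T := by
    rintro l x ⟨hx, i, rfl⟩
    have h0 := hP3 (σ i)
    simp only [Function.comp_apply, Equiv.symm_apply_apply] at h0
    have := hP2 (c i) (P (c i) ∩ T) Set.inter_subset_left
      ⟨t (σ i), h0, ((mt _).1 ⟨_, rfl⟩).2⟩ ?_ hx
    · exact this.2
    · rintro a - b hb ⟨-, -, a', b', rfl, rfl, hab⟩
      exact ⟨hb, hab.2.2⟩
  have hPM : ∀ l i, c i ≠ l → Disjoint (P' l) (M i) := by
    intro l i hne
    rw [Set.disjoint_left]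
    intro x hx hx'
    obtain ⟨j, rfl⟩ := (mt x).2 ⟨hMS i hx', hP'T l hx⟩
    have e1 : σ.symm j = i := by
      by_contra hij
      refine Set.disjoint_left.1 (hM1 _ _ hij) ?_ hx'
      have := hM4 (σ.symm j)
      rwa [Equiv.apply_symm_apply] at this
    have e2 : l = c i := by
      by_contra hl
      have := hP3 j
      rw [Function.comp_apply, e1] at this
      exact Set.disjoint_left.1 (hP1 _ _ hl) hx.1 this
    exact hne e2.symm
  refine ⟨fun l => P' l ∪ ⋃ i : {i // c i = l}, M i, fun l m hlm => ?_, fun l => ?_, fun i =>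
    .inr (Set.mem_iUnion.2 ⟨⟨i, rfl⟩, hM3 i⟩)⟩
  · rw [Set.disjoint_left]
    rintro x (hx | hx) (hy | hy)
    · exact Set.disjoint_left.1 (hP1 l m hlm) hx.1 hy.1
    · obtain ⟨⟨i, rfl⟩, hi⟩ := Set.mem_iUnion.1 hy
      exact Set.disjoint_left.1 (hPM l i hlm.symm) hx hi
    · obtain ⟨⟨i, rfl⟩, hi⟩ := Set.mem_iUnion.1 hx
      exact Set.disjoint_left.1 (hPM m i hlm) hy hi
    · obtain ⟨⟨i, rfl⟩, hi⟩ := Set.mem_iUnion.1 hx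
      obtain ⟨⟨j, rfl⟩, hj⟩ := Set.mem_iUnion.1 hy
      exact Set.disjoint_left.1 (hM1 i j fun h => hlm (by rw [h])) hi hj
  · refine ConnOn.union_iUnion ?_ (fun i => (hM2 i).mono (within_le _ _)) ?_
    · by_cases hl : ∃ i, c i = l
      · have : P' l = P l := by ext x; simp [P', hl]
        rw [this]
        exact (hP2 l).mono hle
      · have : P' l = ∅ := by ext x; simp [P', hl]
        rw [this]
        exact connOn_empty _
    · rintro ⟨i, rfl⟩
      have h0 := hP3 (σ i)
      simp only [Function.comp_apply, Equiv.symm_apply_apply] at h0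
      exact ⟨t (σ i), ⟨h0, i, rfl⟩, hM4 i⟩

end Tight

/-! ### The linkage lemma -/

/-- A simple form of the Robertson–Seymour linkage lemma: terminals that no small separation cuts
off from the branch sets of a large complete minor can be linked according to any labelling. -/
theorem WellAttached.linked [Fintype V] {ι κ L : Type*} [Fintype ι] [Fintype κ]
    (hcard : 2 * Fintype.card ι ≤ Fintype.card κ) (n : ℕ) :
    ∀ (G : SimpleGraph V) (z : ι → V) (B : κ → Set V) (c : ι → L), G.supportCard ≤ n →
      z.Injective → (∀ i j, ¬ G.Adj (z i) (z j)) →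
      (G.completeOn (Set.range z)).IsCliqueModel B → G.WellAttached z B → G.Linked z c := by
  induction n with
  | zero =>
    intro G z B c hn hz hzz hB hatt
    refine linked_of_rigid c hz hzz hB hcard hatt fun u v huv => ?_
    have : u ∈ Finset.univ.filter fun x => ∃ y, G.Adj x y := by simpa using ⟨v, huv⟩
    rw [Finset.card_eq_zero.1 (Nat.le_zero.1 hn)] at this
    simp at this
  | succ n ih =>
    intro G z B c hn hz hzz hB hatt
    by_cases hrig : ∀ u v, G.Adj u v → v ∉ Set.range z → ∃ k m, k ≠ m ∧ u ∈ B k ∧ v ∈ B m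
    · exact linked_of_rigid c hz hzz hB hcard hatt hrig
    push Not at hrig
    obtain ⟨u, v, huv, hv, hkm⟩ := hrig
    have huvB : ¬ ∃ k m, k ≠ m ∧ u ∈ B k ∧ v ∈ B m := by
      rintro ⟨k, m, h1, h2, h3⟩
      exact hkm k m h1 h2 h3
    let φ : V → V := fun x => if x = v then u else x
    have hφu : φ v = u := by simp [φ]
    have hφ : ∀ a, a ≠ v → φ a = a := fun a ha => by simp [φ, ha]
    have hφz : ∀ i, φ (z i) = z i := fun i => hφ _ fun h => hv ⟨i, h⟩
    have hφ2 : ∀ a b, φ a = φ b → a = b ∨ (a = u ∧ b = v) ∨ (a = v ∧ b = u) := by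
      intro a b hab
      by_cases ha : a = v <;> by_cases hb : b = v
      · exact .inl (ha.trans hb.symm)
      · rw [ha, hφu, hφ b hb] at hab; exact .inr (.inr ⟨ha, hab.symm⟩)
      · rw [hb, hφu, hφ a ha] at hab; exact .inr (.inl ⟨hab, hb⟩)
      · rw [hφ a ha, hφ b hb] at hab; exact .inl hab
    by_cases hatt' : (G.imageOff φ (Set.range z)).WellAttached z fun k => φ '' B k
    · refine Linked.of_image (ih _ z _ c ?_ hz ?_ (hB.image hφz hφ2 huvB) hatt') huv hφz hφ2
      · have := supportCard_imageOff_lt huv (Set.range z) hφu hφ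
        omega
      · exact fun i j h => h.2.1 ⟨⟨i, rfl⟩, ⟨j, rfl⟩⟩
    obtain ⟨S, T, hST, hzS, ⟨k₀, hk₀⟩, hST', hvST⟩ :=
      exists_tight_separation hatt hφ hφz hatt'
    obtain ⟨f⟩ : Nonempty (ι ≃ (S ∩ T : Finset V)) :=
      Fintype.card_eq.1 (by rw [Fintype.card_coe]; exact hST'.symm)
    let t : ι → V := fun i => f i
    have htinj : t.Injective := fun i j h => f.injective (Subtype.ext h)
    have ht : Set.range t = (S ∩ T : Finset V) := by
      ext x
      constructor
      · rintro ⟨i, rfl⟩; exact (f i).2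
      · intro hx; exact ⟨f.symm ⟨x, hx⟩, by simp [t]⟩
    -- some terminal is not in the separator, and it is not isolated
    obtain ⟨i₀, hi₀⟩ : ∃ i, z i ∉ S ∩ T := by
      by_contra! hall
      have h1 : Finset.univ.image z ⊆ S ∩ T := by
        intro x hx
        obtain ⟨i, -, rfl⟩ := Finset.mem_image.1 hx
        exact hall i
      have h2 := Finset.eq_of_subset_of_card_le h1
        (by rw [Finset.card_image_of_injective _ hz, Finset.card_univ, hST'])
      rw [← h2] at hvST
      obtain ⟨i, -, hi⟩ := Finset.mem_image.1 hvST
      exact hv ⟨i, hi⟩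
    have hi₀T : z i₀ ∉ T := fun h => hi₀ (Finset.mem_inter.2 ⟨hzS i₀, h⟩)
    -- If `z i₀` were isolated, the other terminals alone would form a separator of order `|ι| - 1`.
    -- Since `z i₀` becomes isolated once the graph is restricted to `T`, the induction measure
    -- drops.
    have hiso : ∃ y, G.Adj (z i₀) y := by
      by_contra! hno
      have h1 := card_free_le (z := z) hB hcard
      have hι : 0 < Fintype.card ι := Fintype.card_pos_iff.2 ⟨i₀⟩
      obtain ⟨k, hk⟩ := Finset.card_pos.1 (lt_of_lt_of_le hι h1)
      have h2 := hatt (Finset.univ.image z) {z i₀}ᶜ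
        ⟨fun x => ?_, fun x y hxy => .inr ?_⟩ (by simp) ⟨k, ?_⟩
      · have h3 : Finset.univ.image z ∩ {z i₀}ᶜ ⊆ (Finset.univ.image z).erase (z i₀) := by
          intro x
          simp only [Finset.mem_inter, Finset.mem_compl, Finset.mem_singleton, Finset.mem_erase]
          tauto
        have h4 := Finset.card_le_card h3
        rw [Finset.card_erase_of_mem (by simp), Finset.card_image_of_injective _ hz,
          Finset.card_univ] at h4
        omega
      · by_cases hx : x = z i₀
        · left; simp [hx]
        · right; simpa using hx
      · simp only [Finset.mem_compl, Finset.mem_singleton]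
        exact ⟨fun h => hno y (h ▸ hxy), fun h => hno x (h ▸ hxy.symm)⟩
      · simpa using (Finset.mem_filter.1 hk).2
    -- A smaller separation within `S` would extend across `T` to one of `G` that still has the
    -- branch set `B k₀` strictly on the right.
    obtain ⟨σ, M, hM1, hM2, hM3, hM4⟩ := menger _ (G.within (S : Set V)) z t hz htinj le_rfl (by
      intro S' T' h' hzS' htT'
      obtain ⟨h1, h2⟩ := hST.extend_left h' (fun x hx => by
        obtain ⟨i, rfl⟩ : x ∈ Set.range t := by rw [ht]; exact hx
        exact htT' i)
      refine (hatt _ _ h1 (fun i => by simp [hzS' i, hzS i]) ⟨k₀, hk₀.mono_right ?_⟩).trans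
        (Finset.card_le_card h2)
      exact_mod_cast Finset.inter_subset_right)
    refine Linked.of_restrict (σ := σ) (ih _ t _ (c ∘ σ.symm) ?_ htinj ?_
      (hB.restrict hST hzS hk₀ ht) (hatt.restrict hB hST hzS hk₀ ht)) hzS ht hM1 hM2 hM3 hM4
    · have : ((G.within (T : Set V)).imageOff id (Set.range t)).supportCard < G.supportCard := by
        refine Finset.card_lt_card ((Finset.ssubset_iff_of_subset ?_).2 ⟨z i₀, ?_, ?_⟩)
        · intro x hx
          simp only [Finset.mem_filter, Finset.mem_univ, true_and] at hx ⊢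
          obtain ⟨y, -, -, a, b, rfl, rfl, hab⟩ := hx
          exact ⟨b, hab.1⟩
        · simpa using hiso
        · simp only [Finset.mem_filter, Finset.mem_univ, true_and, not_exists]
          rintro y ⟨-, -, a, b, ha, -, hab⟩
          rw [id] at ha
          exact hi₀T (ha ▸ hab.2.1)
      omega
    · exact fun i j h => h.2.1 ⟨⟨i, rfl⟩, ⟨j, rfl⟩⟩

/-! ### Degree sums -/

section Density

variable (G : SimpleGraph V)

/-- The number of neighbours of `x` in `W`. -/
noncomputable def degIn (W : Finset V) (x : V) : ℕ := (W.filter (G.Adj x)).card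

/-- Twice the number of edges inside `W`. -/
noncomputable def degSum (W : Finset V) : ℕ := ∑ x ∈ W, G.degIn W x

variable {G}

theorem degIn_insert {W : Finset V} {x : V} (hx : x ∉ W) (y : V) :
    G.degIn (insert x W) y = G.degIn W y + if G.Adj y x then 1 else 0 := by
  unfold degIn
  rw [Finset.filter_insert]
  split_ifs with h
  · rw [Finset.card_insert_of_notMem (by simp [hx])]
  · simp

theorem degSum_insert {W : Finset V} {x : V} (hx : x ∉ W) :
    G.degSum (insert x W) = G.degSum W + 2 * G.degIn W x := by
  unfold degSum
  rw [Finset.sum_insert hx, degIn_insert hx]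
  simp only [degIn_insert hx, Finset.sum_add_distrib, G.loopless.irrefl, if_false, add_zero]
  rw [← Finset.card_filter]
  simp only [degIn, G.adj_comm x]
  ring

theorem degSum_erase {W : Finset V} {x : V} (hx : x ∈ W) :
    G.degSum W = G.degSum (W.erase x) + 2 * G.degIn W x := by
  have h1 := degSum_insert (G := G) (Finset.notMem_erase x W)
  have h2 := degIn_insert (G := G) (Finset.notMem_erase x W) x
  rw [Finset.insert_erase hx] at h1 h2
  simp at h2
  rw [h1, h2]

theorem degSum_eq_card (W : Finset V) :
    G.degSum W = ((W ×ˢ W).filter fun p => G.Adj p.1 p.2).card := by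
  unfold degSum degIn
  rw [Finset.card_filter, Finset.sum_product]
  exact Finset.sum_congr rfl fun x _ => Finset.card_filter _ _

theorem degSum_le_add {W A B : Finset V}
    (h : ∀ x ∈ W, ∀ y ∈ W, G.Adj x y → (x ∈ A ∧ y ∈ A) ∨ (x ∈ B ∧ y ∈ B)) :
    G.degSum W ≤ G.degSum A + G.degSum B := by
  rw [degSum_eq_card, degSum_eq_card, degSum_eq_card]
  refine (Finset.card_le_card ?_).trans (Finset.card_union_le _ _)
  rintro ⟨x, y⟩ hxy
  simp only [Finset.mem_filter, Finset.mem_product, Finset.mem_union] at hxy ⊢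
  have := h x hxy.1.1 y hxy.1.2 hxy.2
  tauto

theorem degIn_lt_card {W : Finset V} {x : V} (hx : x ∈ W) : G.degIn W x < W.card :=
  Finset.card_lt_card ((Finset.ssubset_iff_of_subset (Finset.filter_subset _ _)).2
    ⟨x, hx, by simp⟩)

theorem degSum_le_sq (W : Finset V) : G.degSum W ≤ W.card * W.card := by
  unfold degSum
  refine (Finset.sum_le_card_nsmul W _ W.card fun x hx => (degIn_lt_card hx).le).trans ?_
  simp

theorem mul_card_le_degSum {W A : Finset V} {k : ℕ} (hA : A ⊆ W) (h : ∀ x ∈ A, k ≤ G.degIn W x) :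
    k * A.card ≤ G.degSum W := by
  calc k * A.card = A.card • k := by simp [mul_comm]
    _ ≤ ∑ x ∈ A, G.degIn W x := Finset.card_nsmul_le_sum _ _ _ h
    _ ≤ G.degSum W := Finset.sum_le_sum_of_subset hA

/-- A dense set contains a set of large minimum degree. -/
theorem exists_minDegree_subset {U : Finset V} {k : ℕ} (h : 2 * k * U.card < G.degSum U) :
    ∃ W ⊆ U, W.Nonempty ∧ ∀ x ∈ W, k < G.degIn W x := by
  induction U using Finset.strongInduction with
  | _ U ih =>
    by_cases hd : ∀ x ∈ U, k < G.degIn U x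
    · refine ⟨U, subset_rfl, ?_, hd⟩
      rw [Finset.nonempty_iff_ne_empty]
      rintro rfl
      simp [degSum] at h
    · push Not at hd
      obtain ⟨x, hx, hxd⟩ := hd
      obtain ⟨W, hW, h1⟩ := ih (U.erase x) (Finset.erase_ssubset hx) (by
        have h1 := degSum_erase (G := G) hx
        have h2 := Finset.card_erase_add_one hx
        rw [← h2] at h
        nlinarith)
      exact ⟨W, hW.trans (Finset.erase_subset _ _), h1⟩

theorem degIn_within {W U : Finset V} (hU : U ⊆ W) {x : V} (hx : x ∈ W) :
    (G.within (W : Set V)).degIn U x = G.degIn U x := by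
  unfold degIn
  congr 1
  ext y
  simp only [Finset.mem_filter, within, Finset.mem_coe]
  constructor
  · tauto
  · exact fun h => ⟨h.1, h.2, hx, hU h.1⟩

theorem degSum_within {W U : Finset V} (hU : U ⊆ W) :
    (G.within (W : Set V)).degSum U = G.degSum U :=
  Finset.sum_congr rfl fun _ hx => degIn_within hU (hU hx)

end Density

/-! ### Mader's theorem on complete minors -/

section CliqueMinor

variable {G : SimpleGraph V}

/-- The neighbours of `U` in `W` outside `U`. -/
noncomputable def nbrsIn (G : SimpleGraph V) (W U : Finset V) : Finset V :=
  (W \ U).filter fun y => ∃ x ∈ U, G.Adj x y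

theorem IsCliqueModel.cons {t : ℕ} {B : Fin t → Set V} (hB : G.IsCliqueModel B) {U : Set V}
    (hne : U.Nonempty) (hU : G.ConnOn U) (hd : ∀ k, Disjoint U (B k))
    (hadj : ∀ k, ∃ x ∈ U, ∃ y ∈ B k, G.Adj x y) :
    G.IsCliqueModel (Fin.cons U B : Fin (t + 1) → Set V) := by
  refine ⟨Fin.cases ?_ ?_, Fin.cases ?_ ?_, Fin.cases ?_ ?_, Fin.cases ?_ ?_⟩
  · simpa using hne
  · simpa using hB.nonempty
  · simpa using hU
  · simpa using hB.conn
  · exact Fin.cases (by simp) fun k _ => by simpa using hd k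
  · exact fun k => Fin.cases (fun _ => by simpa using (hd k).symm) fun m hkm => by
      simpa using hB.disj k m (by simpa using hkm)
  · exact Fin.cases (by simp) fun k _ => by simpa using hadj k
  · refine fun k => Fin.cases (fun _ => ?_) fun m hkm => ?_
    · obtain ⟨x, hx, y, hy, hxy⟩ := hadj k
      exact ⟨y, by simpa using hy, x, by simpa using hx, hxy.symm⟩
    · simpa using hB.adj k m (by simpa using hkm)

/-- Mader: average degree at least `2 ^ (t + 1)` forces a complete minor of order `t`. -/
theorem exists_isCliqueModel (t : ℕ) : ∀ W : Finset V, W.Nonempty →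
    2 * 2 ^ t * W.card ≤ G.degSum W →
      ∃ B : Fin t → Set V, G.IsCliqueModel B ∧ ∀ k, B k ⊆ W := by
  induction t with
  | zero => exact fun W _ _ => ⟨fun k => k.elim0, ⟨fun k => k.elim0, fun k => k.elim0,
      fun k => k.elim0, fun k => k.elim0⟩, fun k => k.elim0⟩
  | succ t ih =>
    intro W
    induction W using Finset.strongInduction with
    | _ W ihW =>
    intro hW hd
    set e := 2 * 2 ^ (t + 1) with he
    have he' : 4 ≤ e := by
      have := Nat.one_le_two_pow (n := t)
      rw [he, pow_succ]; omega
    by_cases hsmall : ∃ W' ⊂ W, W'.Nonempty ∧ e * W'.card ≤ G.degSum W'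
    · obtain ⟨W', hW', hne, hd'⟩ := hsmall
      obtain ⟨B, hB, hBW⟩ := ihW W' hW' hne hd'
      exact ⟨B, hB, fun k => (hBW k).trans (Finset.coe_subset.2 hW'.subset)⟩
    -- a maximal connected set whose contraction keeps the density
    let Q : Finset V → Prop := fun U => U ⊆ W ∧ U.Nonempty ∧ G.ConnOn (U : Set V) ∧
      e * ((W \ U).card + 1) ≤ G.degSum (W \ U) + 2 * (G.nbrsIn W U).card
    obtain ⟨x₀, hx₀⟩ := hW
    have hQ0 : Q {x₀} := by
      refine ⟨by simpa using hx₀, by simp, by simpa using connOn_singleton G x₀, ?_⟩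
      have h1 := degSum_erase (G := G) hx₀
      have h2 := Finset.card_erase_add_one hx₀
      have h3 : G.nbrsIn W {x₀} = W.filter (G.Adj x₀) := by
        ext y
        simp only [nbrsIn, Finset.mem_filter, Finset.mem_sdiff, Finset.mem_singleton,
          exists_eq_left]
        constructor
        · tauto
        · exact fun h => ⟨⟨h.1, fun hy => G.loopless.irrefl _ (hy ▸ h.2)⟩, h.2⟩
      rw [Finset.sdiff_singleton_eq_erase, h2, h3]
      unfold degIn at h1
      omega
    obtain ⟨U, hU, hmax⟩ := (W.powerset.filter Q).exists_max_image Finset.card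
      ⟨{x₀}, Finset.mem_filter.2 ⟨Finset.mem_powerset.2 hQ0.1, hQ0⟩⟩
    obtain ⟨hUW, hUne, hUc, hUd⟩ := (Finset.mem_filter.1 hU).2
    set N := G.nbrsIn W U with hN
    have hNmem : ∀ y, y ∈ N ↔ (y ∈ W ∧ y ∉ U) ∧ ∃ x ∈ U, G.Adj x y := by simp [hN, nbrsIn]
    -- Without neighbours of `U`, the smaller set `W \ U` would itself be dense enough.
    have hNne : N.Nonempty := by
      rw [Finset.nonempty_iff_ne_empty]
      intro h0
      rw [h0] at hUd
      simp only [Finset.card_empty, mul_zero, add_zero] at hUd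
      by_cases hWU : (W \ U).Nonempty
      · exact hsmall ⟨W \ U, Finset.sdiff_ssubset hUW hUne, hWU, by nlinarith⟩
      · rw [Finset.not_nonempty_iff_eq_empty] at hWU
        rw [hWU] at hUd
        simp [degSum] at hUd
        omega
    -- Absorbing `y` into `U` destroys one edge plus one for each neighbour of `y` in `N`. By
    -- maximality of `U` this is more than `e / 2`, and `e / 2 = 2 * 2 ^ t`. So the neighbourhood of
    -- the contracted `U` is dense and yields the other branch sets.
    have hNdeg : ∀ y ∈ N, 2 * 2 ^ t ≤ G.degIn N y := by
      intro y hy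
      obtain ⟨⟨hyW, hyU⟩, x, hx, hxy⟩ := (hNmem y).1 hy
      have hyWU : y ∈ W \ U := Finset.mem_sdiff.2 ⟨hyW, hyU⟩
      have hWU' : W \ insert y U = (W \ U).erase y := by
        ext v; simp only [Finset.mem_sdiff, Finset.mem_insert, Finset.mem_erase]; tauto
      have hnot : ¬ Q (insert y U) := by
        intro hQ
        have := hmax (insert y U) (Finset.mem_filter.2 ⟨Finset.mem_powerset.2 hQ.1, hQ⟩)
        rw [Finset.card_insert_of_notMem hyU] at this
        omega
      have hlt : G.degSum ((W \ U).erase y) + 2 * (G.nbrsIn W (insert y U)).card <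
          e * (((W \ U).erase y).card + 1) := by
        by_contra! hge
        refine hnot ⟨Finset.insert_subset hyW hUW, ⟨y, by simp⟩, ?_, by rwa [hWU']⟩
        rw [Finset.coe_insert, Set.insert_eq, Set.union_comm]
        exact hUc.union (connOn_singleton G y) hx rfl (.inr hxy)
      rw [Finset.card_erase_add_one hyWU] at hlt
      have hsum := degSum_erase (G := G) hyWU
      have hsub : N.erase y ∪ (W \ U).filter (G.Adj y) ⊆ G.nbrsIn W (insert y U) := by
        intro v hv
        simp only [nbrsIn, Finset.mem_union, Finset.mem_erase, hNmem, Finset.mem_filter,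
          Finset.mem_sdiff, Finset.mem_insert] at hv ⊢
        rcases hv with ⟨h1, ⟨h2, h3⟩, a, ha, hav⟩ | ⟨⟨h1, h2⟩, h3⟩
        · exact ⟨⟨h2, by tauto⟩, a, .inr ha, hav⟩
        · refine ⟨⟨h1, ?_⟩, y, .inl rfl, h3⟩
          rintro (rfl | h)
          exacts [G.loopless.irrefl _ h3, h2 h]
      have hinter : N.erase y ∩ (W \ U).filter (G.Adj y) ⊆ N.filter (G.Adj y) := by
        intro v
        simp only [Finset.mem_inter, Finset.mem_erase, Finset.mem_filter]
        tauto
      have c1 := Finset.card_le_card hsub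
      have c2 := Finset.card_le_card hinter
      have c3 := Finset.card_union_add_card_inter (N.erase y) ((W \ U).filter (G.Adj y))
      have c4 := Finset.card_erase_add_one hy
      have c5 : e = 2 * (2 * 2 ^ t) := by rw [he, pow_succ]; ring
      unfold degIn at hsum ⊢
      rw [mul_add] at hUd
      omega
    obtain ⟨B, hB, hBN⟩ := ih N hNne (mul_card_le_degSum subset_rfl hNdeg)
    refine ⟨Fin.cons U B, hB.cons hUne hUc (fun k => ?_) (fun k => ?_), Fin.cases ?_ fun k => ?_⟩
    · rw [Set.disjoint_left]
      exact fun v hv hv' => ((hNmem v).1 (hBN k hv')).1.2 hv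
    · obtain ⟨y, hy⟩ := hB.nonempty k
      obtain ⟨-, x, hx, hxy⟩ := (hNmem y).1 (hBN k hy)
      exact ⟨x, hx, y, hy, hxy⟩
    · simpa using hUW
    · exact fun v hv => ((hNmem v).1 (hBN k (by simpa using hv))).1.1

end CliqueMinor

/-! ### Girth, clusterings and the Moore bound -/

/-- Every cycle of `G` has length at least `g`. -/
def GirthAtLeast (G : SimpleGraph V) (g : ℕ) : Prop :=
  ∀ (w : V) (c : G.Walk w w), c.IsCycle → g ≤ c.length

theorem GirthAtLeast.mono {G H : SimpleGraph V} {g : ℕ} (h : G.GirthAtLeast g) (hle : H ≤ G) :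
    H.GirthAtLeast g := by
  intro w c hc
  have := h w (c.mapLe hle) (hc.mapLe hle)
  simpa using this

/-- Shortening `q` to a path keeps it off the edge `xy`, which then closes it to a cycle. -/
theorem GirthAtLeast.le_of_walk {G : SimpleGraph V} {g : ℕ} (h : G.GirthAtLeast g) {x y : V}
    (hxy : G.Adj x y) (q : G.Walk y x) (hq : s(x, y) ∉ q.edges) : g ≤ q.length + 1 := by
  have hc : (Walk.cons hxy q.bypass).IsCycle :=
    (Walk.cons_isCycle_iff _ _).2 ⟨q.bypass_isPath, fun he => hq (q.edges_bypass_subset_edges he)⟩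
  refine (h _ _ hc).trans ?_
  rw [Walk.length_cons]
  exact Nat.succ_le_succ q.length_bypass_le_length

/-- The vertices at distance at most `k` from `X`. -/
def reach (G : SimpleGraph V) (X : Set V) : ℕ → Set V
  | 0 => X
  | k + 1 => {y | y ∈ reach G X k ∨ ∃ x ∈ reach G X k, G.Adj x y}

section Girth

variable {G : SimpleGraph V}

theorem reach_mono_right (X : Set V) {j k : ℕ} (h : j ≤ k) : G.reach X j ⊆ G.reach X k := by
  induction k, h using Nat.le_induction with
  | base => exact subset_rfl
  | succ k _ ih => exact fun x hx => .inl (ih hx)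

theorem reach_mono_left {X Y : Set V} (h : X ⊆ Y) (k : ℕ) : G.reach X k ⊆ G.reach Y k := by
  induction k with
  | zero => exact h
  | succ k ih =>
    rintro x (hx | ⟨y, hy, hyx⟩)
    exacts [.inl (ih hx), .inr ⟨y, ih hy, hyx⟩]

theorem reach_subset {X W : Set V} (hX : X ⊆ W) (hW : ∀ x y, G.Adj x y → y ∈ W) (k : ℕ) :
    G.reach X k ⊆ W := by
  induction k with
  | zero => exact hX
  | succ k ih =>
    rintro x (hx | ⟨y, hy, hyx⟩)
    exacts [ih hx, hW y x hyx]

theorem exists_walk_of_mem_reach {X : Set V} {k : ℕ} {x : V} (hx : x ∈ G.reach X k) :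
    ∃ a ∈ X, ∃ q : G.Walk a x, q.length ≤ k := by
  induction k generalizing x with
  | zero => exact ⟨x, hx, .nil, le_rfl⟩
  | succ k ih =>
    rcases hx with hx | ⟨y, hy, hyx⟩
    · obtain ⟨a, ha, q, hq⟩ := ih hx
      exact ⟨a, ha, q, hq.trans (Nat.le_succ k)⟩
    · obtain ⟨a, ha, q, hq⟩ := ih hy
      exact ⟨a, ha, q.concat hyx, by simpa using hq⟩

theorem mem_reach_of_walk {X : Set V} {a x : V} (q : G.Walk a x) (i : ℕ) (ha : a ∈ G.reach X i) :
    x ∈ G.reach X (i + q.length) := by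
  induction q generalizing i with
  | nil => exact ha
  | cons h q ih =>
    have := ih (i + 1) (.inr ⟨_, ha, h⟩)
    rwa [Walk.length_cons, add_comm q.length, ← add_assoc]

/-- A breadth-first clustering around the centres `X`, with parent map `p` and centre map `c`. -/
structure IsClustering (G : SimpleGraph V) (X : Set V) (k : ℕ) (p c : V → V) : Prop where
  center : ∀ x ∈ X, c x = x
  center_mem : ∀ x ∈ G.reach X k, c x ∈ X
  walk : ∀ j ≤ k, ∀ x ∈ G.reach X j, ∃ q : G.Walk x (c x), q.length ≤ j ∧
    (∀ v ∈ q.support, v ∈ G.reach X k ∧ c v = c x) ∧ ∀ e ∈ q.edges, ∃ z, e = s(z, p z)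

/-- Built layer by layer: a newly reached vertex takes a chosen earlier neighbour as parent and
inherits its centre. -/
theorem exists_isClustering (G : SimpleGraph V) (X : Set V) (k : ℕ) :
    ∃ p c, G.IsClustering X k p c := by
  induction k with
  | zero =>
    refine ⟨id, id, fun _ _ => rfl, fun _ h => h, fun j hj x hx => ⟨.nil, by simp, ?_, by simp⟩⟩
    rw [Nat.le_zero.1 hj] at hx
    simpa using hx
  | succ k ih =>
    obtain ⟨p, c, h⟩ := ih
    have hnb : ∀ x, ∃ y, x ∈ G.reach X (k + 1) → x ∉ G.reach X k → y ∈ G.reach X k ∧ G.Adj y x := by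
      intro x
      by_cases hx : x ∈ G.reach X (k + 1) ∧ x ∉ G.reach X k
      · obtain ⟨y, hy, hyx⟩ := hx.1.resolve_left hx.2
        exact ⟨y, fun _ _ => ⟨hy, hyx⟩⟩
      · exact ⟨x, fun h1 h2 => (hx ⟨h1, h2⟩).elim⟩
    choose nb hnb using hnb
    let p' : V → V := fun x => if x ∈ G.reach X k then p x else nb x
    let c' : V → V := fun x => if x ∈ G.reach X k then c x else c (nb x)
    have hp : ∀ x ∈ G.reach X k, p' x = p x := fun x hx => by simp [p', hx]
    have hc : ∀ x ∈ G.reach X k, c' x = c x := fun x hx => by simp [c', hx]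
    have hp' : ∀ x ∉ G.reach X k, p' x = nb x := fun x hx => by simp [p', hx]
    have hc' : ∀ x ∉ G.reach X k, c' x = c (nb x) := fun x hx => by simp [c', hx]
    have hmono := reach_mono_right (G := G) X (Nat.le_succ k)
    have hold : ∀ j ≤ k, ∀ x ∈ G.reach X j, ∃ q : G.Walk x (c x), q.length ≤ j ∧
        (∀ v ∈ q.support, v ∈ G.reach X k ∧ c' v = c x) ∧ ∀ e ∈ q.edges, ∃ z, e = s(z, p' z) := by
      intro j hj x hx
      obtain ⟨q, q1, q2, q3⟩ := h.walk j hj x hx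
      refine ⟨q, q1, fun v hv => ⟨(q2 v hv).1, by rw [hc v (q2 v hv).1]; exact (q2 v hv).2⟩,
        fun e he => ?_⟩
      obtain ⟨z, rfl⟩ := q3 e he
      exact ⟨z, by rw [hp z (q2 z (q.fst_mem_support_of_mem_edges he)).1]⟩
    refine ⟨p', c', fun x hx => ?_, fun x hx => ?_, fun j hj x hx => ?_⟩
    · rw [hc x (reach_mono_right X (Nat.zero_le k) hx)]
      exact h.center x hx
    · by_cases hxk : x ∈ G.reach X k
      · rw [hc x hxk]; exact h.center_mem x hxk
      · rw [hc' x hxk]; exact h.center_mem _ (hnb x hx hxk).1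
    · by_cases hxk : x ∈ G.reach X k
      · rw [hc x hxk]
        have : x ∈ G.reach X (min j k) := by
          rcases le_total j k with hjk | hjk
          · rwa [min_eq_left hjk]
          · rwa [min_eq_right hjk]
        obtain ⟨q, q1, q2, q3⟩ := hold _ (min_le_right j k) x this
        exact ⟨q, q1.trans (min_le_left j k), fun v hv => ⟨hmono (q2 v hv).1, (q2 v hv).2⟩, q3⟩
      · obtain ⟨h1, h2⟩ := hnb x (reach_mono_right X hj hx) hxk
        have hjk : j = k + 1 := by
          by_contra hne
          exact hxk (reach_mono_right X (by omega) hx)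
        rw [hc' x hxk]
        obtain ⟨q, q1, q2, q3⟩ := hold k le_rfl _ h1
        refine ⟨.cons h2.symm q, by simp; omega, fun v hv => ?_, fun e he => ?_⟩
        · rw [Walk.support_cons, List.mem_cons] at hv
          rcases hv with rfl | hv
          · exact ⟨reach_mono_right X hj hx, hc' v hxk⟩
          · exact ⟨hmono (q2 v hv).1, (q2 v hv).2⟩
        · rw [Walk.edges_cons, List.mem_cons] at he
          rcases he with rfl | he
          · exact ⟨x, by rw [hp' x hxk]⟩
          · exact q3 e he

/-- Any other edge would close, through the parent walks to the common centre, a cycle of length at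
most `2 k + 1`. So each cluster induces a forest. -/
theorem IsClustering.parent_of_adj {X : Set V} {k g : ℕ} {p c : V → V}
    (h : G.IsClustering X k p c) (hg : G.GirthAtLeast g) (hk : 2 * k + 1 < g) {x y : V}
    (hx : x ∈ G.reach X k) (hy : y ∈ G.reach X k) (hxy : G.Adj x y) (hc : c x = c y) :
    y = p x ∨ x = p y := by
  obtain ⟨q, q1, -, q3⟩ := h.walk k le_rfl x hx
  obtain ⟨q', r1, -, r3⟩ : ∃ q' : G.Walk y (c x), q'.length ≤ k ∧ True ∧
      ∀ e ∈ q'.edges, ∃ z, e = s(z, p z) := by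
    obtain ⟨q', r1, -, r3⟩ := h.walk k le_rfl y hy
    rw [hc]
    exact ⟨q', r1, trivial, r3⟩
  by_contra hne
  have := hg.le_of_walk hxy (q'.append q.reverse) (by
    intro he
    have : ∃ z, s(x, y) = s(z, p z) := by
      rw [Walk.edges_append, List.mem_append, Walk.edges_reverse, List.mem_reverse] at he
      exact he.elim (r3 _) (q3 _)
    obtain ⟨z, hz⟩ := this
    rcases Sym2.eq_iff.1 hz with ⟨rfl, h⟩ | ⟨h, rfl⟩
    exacts [hne (.inl h), hne (.inr h)])
  rw [Walk.length_append, Walk.length_reverse] at this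
  omega

theorem IsClustering.card_adj_same_le {X : Set V} {k g : ℕ} {p c : V → V}
    (h : G.IsClustering X k p c) (hg : G.GirthAtLeast g) (hk : 2 * k + 1 < g) {Y : Finset V}
    (hY : ∀ x ∈ Y, x ∈ G.reach X k) :
    ((Y ×ˢ Y).filter fun q => G.Adj q.1 q.2 ∧ c q.1 = c q.2).card ≤ 2 * Y.card := by
  have hsub : (Y ×ˢ Y).filter (fun q => G.Adj q.1 q.2 ∧ c q.1 = c q.2) ⊆
      Y.image (fun x => (x, p x)) ∪ Y.image (fun x => (p x, x)) := by
    rintro ⟨x, y⟩ hxy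
    simp only [Finset.mem_filter, Finset.mem_product] at hxy
    obtain ⟨⟨hx, hy⟩, hadj, hc⟩ := hxy
    rw [Finset.mem_union, Finset.mem_image, Finset.mem_image]
    rcases h.parent_of_adj hg hk (hY x hx) (hY y hy) hadj hc with rfl | rfl
    exacts [.inl ⟨x, hx, rfl⟩, .inr ⟨y, hy, rfl⟩]
  have h1 := (Finset.card_le_card hsub).trans (Finset.card_union_le _ _)
  have h2 : (Y.image fun x => (x, p x)).card ≤ Y.card := Finset.card_image_le
  have h3 : (Y.image fun x => (p x, x)).card ≤ Y.card := Finset.card_image_le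
  omega

/-- Balls grow exponentially up to half the girth. -/
theorem GirthAtLeast.pow_le_card_ball {g m : ℕ} (hg : G.GirthAtLeast g) {W : Finset V}
    (hdeg : ∀ x ∈ W, 2 * m ≤ G.degIn W x) {v : V} (hv : v ∈ W)
    {k : ℕ} (hk : 2 * k + 1 < g) : m ^ k ≤ (W.filter (· ∈ G.reach {v} k)).card := by
  induction k with
  | zero =>
    rw [pow_zero]
    exact Finset.card_pos.2 ⟨v, Finset.mem_filter.2 ⟨hv, rfl⟩⟩
  | succ k ih =>
    have ih := ih (by omega)
    obtain ⟨p, c, h⟩ := exists_isClustering G {v} (k + 1)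
    set Y := W.filter (· ∈ G.reach {v} (k + 1)) with hY
    have h1 := h.card_adj_same_le hg hk (Y := Y) fun x hx => (Finset.mem_filter.1 hx).2
    have h2 : G.degSum Y ≤ 2 * Y.card := by
      rw [degSum_eq_card]
      refine le_trans (Finset.card_le_card ?_) h1
      rintro ⟨x, y⟩ hxy
      rw [Finset.mem_filter, Finset.mem_product] at hxy ⊢
      have e1 := h.center_mem x (Finset.mem_filter.1 hxy.1.1).2
      have e2 := h.center_mem y (Finset.mem_filter.1 hxy.1.2).2
      rw [Set.mem_singleton_iff] at e1 e2
      exact ⟨hxy.1, hxy.2, by rw [e1, e2]⟩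
    -- Vertices of the smaller ball keep all their neighbours in `W` inside the larger one, which
    -- has average degree at most 2 because it is a single cluster.
    have h3 : 2 * m * (W.filter (· ∈ G.reach {v} k)).card ≤ G.degSum Y := by
      refine mul_card_le_degSum ?_ fun x hx => ?_
      · exact Finset.monotone_filter_right _ fun x _ hx => .inl hx
      · rw [Finset.mem_filter] at hx
        refine (hdeg x hx.1).trans (Finset.card_le_card fun y hy => ?_)
        rw [Finset.mem_filter] at hy ⊢
        exact ⟨Finset.mem_filter.2 ⟨hy.1, .inr ⟨x, hx.2, hy.2⟩⟩, hy.2⟩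
    rw [pow_succ]
    have h4 := Nat.mul_le_mul_left m ih
    nlinarith

/-- A Moore-type bound: dense graphs of girth at least `g` have many vertices. -/
theorem GirthAtLeast.lt_card_of_dense {g : ℕ} (hg : G.GirthAtLeast g) (hg3 : 3 ≤ g)
    {U : Finset V} (hU : 2 * 1024 * U.card < G.degSum U) : 6 * g < U.card := by
  obtain ⟨W, hWU, ⟨v, hv⟩, hW⟩ := exists_minDegree_subset hU
  refine lt_of_lt_of_le ?_ (Finset.card_le_card hWU)
  rcases hg3.eq_or_lt with rfl | hg4
  -- For `g = 3` the radius `g / 4` is 0 and the minimum degree alone exceeds 18.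
  · have h1 := hW v hv
    have h2 := degIn_lt_card (G := G) hv
    omega
  · have h1 := (hg.mono (within_le G (W : Set V))).pow_le_card_ball (m := 512) (W := W)
      (fun x hx => by rw [degIn_within subset_rfl hx]; exact (hW x hx).le) hv
      (k := g / 4) (by omega)
    have h2 := h1.trans (Finset.card_filter_le _ _)
    -- With `k = g / 4` one has `g ≤ 4 k + 3`, hence `6 g ≤ 24 k + 18`.
    have h3 : ∀ k : ℕ, 1 ≤ k → 24 * k + 18 < 512 ^ k := by
      intro k hk
      induction k, hk using Nat.le_induction with
      | base => norm_num
      | succ k _ ih => rw [pow_succ]; omega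
    have := h3 (g / 4) (by omega)
    omega

theorem mem_of_walk {S U : Set V} (hcl : ∀ x ∈ U, ∀ y ∈ S, G.Adj x y → y ∈ U) {a b : V}
    (q : G.Walk a b) (hq : ∀ v ∈ q.support, v ∈ S) (ha : a ∈ U) : b ∈ U := by
  induction q with
  | nil => exact ha
  | cons h q ih =>
    simp only [Walk.support_cons, List.mem_cons, forall_eq_or_imp] at hq
    exact ih hq.2 (hcl _ ha _ (hq.2 _ q.start_mem_support) h)

/-- The quotient of `G` on `W` by a map `c`. -/
def quotientOn (G : SimpleGraph V) (W : Set V) (c : V → V) : SimpleGraph V where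
  Adj a b := a ≠ b ∧ ∃ x ∈ W, ∃ y ∈ W, c x = a ∧ c y = b ∧ G.Adj x y
  symm := ⟨fun _ _ h => ⟨h.1.symm, let ⟨x, hx, y, hy, ha, hb, h⟩ := h.2
    ⟨y, hy, x, hx, hb, ha, h.symm⟩⟩⟩
  loopless := ⟨fun _ h => h.1 rfl⟩

/-- A graph of girth at least `g` and large minimum degree has a complete minor of order `5 g`. -/
theorem GirthAtLeast.exists_isCliqueModel {g : ℕ} (hg : G.GirthAtLeast g) (hg3 : 3 ≤ g)
    {W : Finset V} (hne : W.Nonempty) (hW : ∀ x y, G.Adj x y → y ∈ W)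
    (hdeg : ∀ x ∈ W, 2 ^ 60 ≤ G.degIn W x) :
    ∃ B : Fin (5 * g) → Set V, G.IsCliqueModel B ∧ ∀ k, B k ⊆ W := by
  -- Chosen so that `8 r + 2 < g`: two edges between the same two clusters of radius `2 r` would
  -- give a cycle of length at most `4 * 2 r + 2`.
  obtain ⟨r, hr⟩ : ∃ r, r = (g - 3) / 8 := ⟨_, rfl⟩
  let far : Finset V → Prop := fun X => ∀ a ∈ X, ∀ b ∈ X, a ≠ b →
    ∀ q : G.Walk a b, 2 * r < q.length
  -- A largest set of centres at pairwise distance more than `2 r`: the balls of radius `r` are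
  -- disjoint, and by maximality those of radius `2 r` cover `W`.
  obtain ⟨X, hX, hmax⟩ := (W.powerset.filter far).exists_max_image Finset.card
    ⟨∅, by simp [far]⟩
  obtain ⟨hXW, hfar⟩ := Finset.mem_filter.1 hX
  rw [Finset.mem_powerset] at hXW
  have hcover : ∀ w ∈ W, w ∈ G.reach (X : Set V) (2 * r) := by
    intro w hw
    by_cases hwX : w ∈ X
    · exact reach_mono_right _ (Nat.zero_le _) hwX
    by_contra hnr
    have hno : ∀ a ∈ X, ∀ q : G.Walk a w, 2 * r < q.length := by
      intro a ha q
      by_contra! hq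
      have := mem_reach_of_walk q 0 (X := (X : Set V)) ha
      exact hnr (reach_mono_right _ (by omega) this)
    have := hmax (insert w X) (Finset.mem_filter.2 ⟨Finset.mem_powerset.2
      (Finset.insert_subset hw hXW), fun a ha b hb hab q => ?_⟩)
    · rw [Finset.card_insert_of_notMem hwX] at this
      omega
    · rw [Finset.mem_insert] at ha hb
      rcases ha with rfl | ha <;> rcases hb with rfl | hb
      · exact (hab rfl).elim
      · simpa using hno b hb q.reverse
      · exact hno a ha q
      · exact hfar a ha b hb hab q
  obtain ⟨p, c, hcl⟩ := exists_isClustering G (X : Set V) (2 * r)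
  have hreachW : ∀ k, G.reach (X : Set V) k ⊆ W :=
    fun k => reach_subset (Finset.coe_subset.2 hXW) hW k
  have hcX : ∀ x ∈ W, c x ∈ X := fun x hx => hcl.center_mem x (hcover x hx)
  -- balls of radius `r` around the centres lie in different clusters
  have hball : 2 ^ (59 * r) * X.card ≤ W.card := by
    rw [Finset.card_eq_sum_card_fiberwise (f := c) (t := X) hcX, mul_comm, ← smul_eq_mul]
    refine Finset.card_nsmul_le_sum _ _ _ fun a ha => ?_
    have h1 := hg.pow_le_card_ball (m := 2 ^ 59) (fun x hx => by
      have := hdeg x hx; omega) (hXW ha) (k := r) (by omega)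
    rw [pow_mul]
    refine h1.trans (Finset.card_le_card fun x hx => ?_)
    rw [Finset.mem_filter] at hx ⊢
    refine ⟨hx.1, ?_⟩
    obtain ⟨q, q1, -, -⟩ := hcl.walk r (by omega) x
      (reach_mono_left (by simpa using ha) r hx.2)
    obtain ⟨a', rfl, q', q1'⟩ := exists_walk_of_mem_reach hx.2
    by_contra hne
    have := hfar a' ha (c x) (hcX x hx.1) (Ne.symm hne) (q'.append q)
    rw [Walk.length_append] at this
    omega
  -- two clusters are joined by at most one edge
  have huniq : ∀ x ∈ W, ∀ y ∈ W, ∀ x' ∈ W, ∀ y' ∈ W, G.Adj x y → G.Adj x' y' → c x = c x' →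
      c y = c y' → c x ≠ c y → x = x' ∧ y = y' := by
    intro x hx y hy x' hx' y' hy' hxy hxy' hcx hcy hcxy
    by_contra hne
    obtain ⟨q1, l1, s1, -⟩ := hcl.walk _ le_rfl y (hcover y hy)
    obtain ⟨q2, l2, s2, -⟩ := hcl.walk _ le_rfl y' (hcover y' hy')
    obtain ⟨q3, l3, s3, -⟩ := hcl.walk _ le_rfl x' (hcover x' hx')
    obtain ⟨q4, l4, s4, -⟩ := hcl.walk _ le_rfl x (hcover x hx)
    have := hg.le_of_walk hxy ((q1.append ((q2.copy rfl hcy.symm).reverse)).append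
      (.cons hxy'.symm (q3.append ((q4.copy rfl hcx).reverse)))) (by
      intro he
      simp only [Walk.edges_append, Walk.edges_cons, Walk.edges_reverse, Walk.edges_copy,
        List.mem_append, List.mem_cons, List.mem_reverse] at he
      rcases he with (he | he) | he | he | he
      · exact hcxy (s1 x (q1.fst_mem_support_of_mem_edges he)).2
      · exact hcxy ((s2 x (q2.fst_mem_support_of_mem_edges he)).2.trans hcy.symm)
      · rcases Sym2.eq_iff.1 he with ⟨h1, h2⟩ | ⟨h1, h2⟩
        · exact hcxy (by rw [hcy, h1])
        · exact hne ⟨h1, h2⟩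
      · exact hcxy (hcx.trans (s3 y (q3.snd_mem_support_of_mem_edges he)).2.symm)
      · exact hcxy (s4 y (q4.snd_mem_support_of_mem_edges he)).2.symm)
    simp only [Walk.length_append, Walk.length_cons, Walk.length_reverse, Walk.length_copy] at this
    omega
  set M := G.quotientOn (W : Set V) c with hM
  have hinter : ((W ×ˢ W).filter fun q => G.Adj q.1 q.2 ∧ ¬ c q.1 = c q.2).card ≤ M.degSum X := by
    rw [degSum_eq_card]
    refine Finset.card_le_card_of_injOn (fun q => (c q.1, c q.2)) ?_ ?_
    · rintro ⟨x, y⟩ hxy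
      simp only [Finset.coe_filter, Finset.mem_product, Set.mem_ofPred_eq] at hxy ⊢
      exact ⟨⟨hcX x hxy.1.1, hcX y hxy.1.2⟩, hxy.2.2, x, hxy.1.1, y, hxy.1.2, rfl, rfl, hxy.2.1⟩
    · rintro ⟨x, y⟩ hxy ⟨x', y'⟩ hxy' heq
      simp only [Finset.coe_filter, Finset.mem_product, Set.mem_ofPred_eq, Prod.mk.injEq]
        at hxy hxy' heq ⊢
      exact huniq x hxy.1.1 y hxy.1.2 x' hxy'.1.1 y' hxy'.1.2 hxy.2.1 hxy'.2.1 heq.1 heq.2 hxy.2.2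
  have hsame := hcl.card_adj_same_le hg (by omega) hcover
  have hsum : G.degSum W ≤ 2 * W.card + M.degSum X := by
    rw [degSum_eq_card]
    refine le_trans ?_ (Nat.add_le_add hsame hinter)
    rw [← Finset.filter_filter, ← Finset.filter_filter, Finset.card_filter_add_card_filter_not]
  -- Edges inside clusters cost only `2 |W|` of a degree sum of at least `2 ^ 60 |W|`, so `2 ^ 59
  -- |W|` survives, and `|W| ≥ 2 ^ (59 r) |X|`. The exponents fit because `g ≤ 8 r + 10`.
  have hdense : 2 * 2 ^ (5 * g) * X.card ≤ M.degSum X := by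
    have h1 := mul_card_le_degSum subset_rfl hdeg
    have h2 : (2 : ℕ) * 2 ^ (5 * g) ≤ 2 ^ 59 * 2 ^ (59 * r) := by
      rw [← pow_add, ← pow_succ']
      exact Nat.pow_le_pow_right (by norm_num) (by omega)
    have h3 := Nat.mul_le_mul_right X.card h2
    have h4 := Nat.mul_le_mul_left (2 ^ 59) hball
    have h5 : 2 ^ 59 * 2 ^ (59 * r) * X.card = 2 ^ 59 * (2 ^ (59 * r) * X.card) := by ring
    omega
  have hXne : X.Nonempty := by
    obtain ⟨w, hw⟩ := hne
    exact ⟨_, hcX w hw⟩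
  obtain ⟨B, hB, hBX⟩ := SimpleGraph.exists_isCliqueModel (5 * g) X hXne hdense
  refine ⟨fun k => {x | x ∈ W ∧ c x ∈ B k}, ⟨fun k => ?_, fun k => ?_, fun k m hkm => ?_,
    fun k m hkm => ?_⟩, fun k x hx => hx.1⟩
  · obtain ⟨a, ha⟩ := hB.nonempty k
    exact ⟨a, hXW (hBX k ha), by rwa [hcl.center a (hBX k ha)]⟩
  · rintro U hU ⟨x, hx⟩ hUcl
    -- Clusters are connected, so a closed set contains a vertex exactly when it contains its
    -- centre; connectivity thus transfers from the quotient.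
    have hwalk : ∀ y, y ∈ W → c y ∈ B k → (y ∈ U ↔ c y ∈ U) := by
      intro y hy hyB
      obtain ⟨q, -, q2, -⟩ := hcl.walk _ le_rfl y (hcover y hy)
      have hq : ∀ v ∈ q.support, v ∈ {x | x ∈ W ∧ c x ∈ B k} := fun v hv =>
        ⟨hreachW _ (q2 v hv).1, by rw [(q2 v hv).2]; exact hyB⟩
      exact ⟨mem_of_walk hUcl q hq, mem_of_walk hUcl q.reverse (by simpa using hq)⟩
    have hxU := hU hx
    have := hB.conn k (B k ∩ U) Set.inter_subset_left
      ⟨c x, hxU.2, (hwalk x hxU.1 hxU.2).1 hx⟩ ?_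
    · exact fun y hy => (hwalk y hy.1 hy.2).2 (this hy.2).2
    · rintro a ⟨ha, haU⟩ b hb ⟨-, y, hy, y', hy', rfl, rfl, hyy⟩
      refine ⟨hb, (hwalk y' hy' hb).1 (hUcl y ((hwalk y hy ha).2 haU) y' ⟨hy', hb⟩ hyy)⟩
  · rw [Set.disjoint_left]
    exact fun x hx hx' => Set.disjoint_left.1 (hB.disj k m hkm) hx.2 hx'.2
  · obtain ⟨a, ha, b, hb, -, x, hx, y, hy, rfl, rfl, hxy⟩ := hB.adj k m hkm
    exact ⟨x, ⟨hx, ha⟩, y, ⟨hy, hb⟩, hxy⟩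

end Girth

/-! ### Shortest cycles and cores -/

/-- A vertex has at most three neighbours on a shortest cycle. -/
theorem GirthAtLeast.card_adj_cycle_le {G : SimpleGraph V} {g : ℕ} (hg : G.GirthAtLeast g)
    {w : V} {c : G.Walk w w} (hc : c.IsCycle) (hcg : c.length = g) (x : V) :
    (c.support.toFinset.filter (G.Adj x)).card ≤ 3 := by
  have h3 : ∀ a b d : V, ({a, b, d} : Finset V).card ≤ 3 := fun a b d => Finset.card_le_three
  by_cases hx : x ∈ c.support
  · set c' := c.rotate x hx with hc'
    have hcyc : c'.IsCycle := hc.rotate hx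
    -- Start the cycle at `x`. A neighbour at position `i`, not reached along the first edge, closes
    -- a cycle of length at most `i + 1`, so `i ≥ g - 1`.
    refine (Finset.card_le_card ?_).trans (h3 (c'.getVert 1) (c'.getVert (g - 1)) x)
    intro y hy
    rw [Finset.mem_filter, List.mem_toFinset] at hy
    have hy' : y ∈ c'.support := (c.mem_support_rotate_iff x hx).2 hy.1
    set q := c'.takeUntil y hy' with hq
    have hqy : c'.getVert q.length = y := Walk.getVert_length_takeUntil hy'
    have hqg : q.length ≤ g := by
      have := c'.length_takeUntil_le_length hy'
      rwa [Walk.length_rotate, hcg] at this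
    simp only [Finset.mem_insert, Finset.mem_singleton]
    by_cases he : s(y, x) ∈ q.edges
    · left
      have hp : q.IsPath := hcyc.isPath_takeUntil hy'
      have : q.length = 1 := by
        cases hqq : q with
        | nil => exact (G.loopless.irrefl _ hy.2).elim
        | cons h q' =>
          rw [hqq] at hp he
          rw [Walk.cons_isPath_iff] at hp
          rw [Walk.edges_cons, List.mem_cons] at he
          rcases he with he | he
          · rcases Sym2.eq_iff.1 he with ⟨rfl, -⟩ | ⟨rfl, -⟩
            · exact (G.loopless.irrefl _ hy.2).elim
            · rw [Walk.length_cons, Walk.length_eq_zero_iff.2 (Walk.isPath_iff_nil.1 hp.1)]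
          · exact (hp.2 (q'.snd_mem_support_of_mem_edges he)).elim
      rw [← hqy, this]
    · right
      have := hg.le_of_walk hy.2.symm q he
      rcases (by omega : q.length = g - 1 ∨ q.length = g) with h | h
      · left; rw [← hqy, h]
      · right
        rw [← hqy, h, ← hcg, ← Walk.length_rotate c x hx, Walk.getVert_length]
  · by_cases hN : ∃ y, y ∈ c.support ∧ G.Adj x y
    swap
    · rw [Finset.filter_eq_empty_iff.2]
      · simp
      · exact fun y hy h => hN ⟨y, List.mem_toFinset.1 hy, h⟩
    obtain ⟨y₀, hy₀, hxy₀⟩ := hN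
    set c' := c.rotate y₀ hy₀ with hc'
    -- Start the cycle at a neighbour `y₀` of `x`. Another neighbour at position `i` closes through
    -- `x` a cycle of length at most `i + 2`, so `i ≥ g - 2`.
    refine (Finset.card_le_card ?_).trans (h3 (c'.getVert (g - 2)) (c'.getVert (g - 1)) y₀)
    intro y hy
    rw [Finset.mem_filter, List.mem_toFinset] at hy
    have hy' : y ∈ c'.support := (c.mem_support_rotate_iff y₀ hy₀).2 hy.1
    set q := c'.takeUntil y hy' with hq
    have hqy : c'.getVert q.length = y := Walk.getVert_length_takeUntil hy'
    have hqg : q.length ≤ g := by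
      have := c'.length_takeUntil_le_length hy'
      rwa [Walk.length_rotate, hcg] at this
    simp only [Finset.mem_insert, Finset.mem_singleton]
    by_cases hyy : y = y₀
    · exact .inr (.inr hyy)
    have := hg.le_of_walk hxy₀ (q.concat hy.2.symm) (by
      rw [Walk.edges_concat, List.concat_eq_append, List.mem_append, List.mem_singleton]
      rintro (he | he)
      · have := c'.support_takeUntil_subset_support hy' (q.fst_mem_support_of_mem_edges he)
        exact hx ((c.mem_support_rotate_iff y₀ hy₀).1 this)
      · rcases Sym2.eq_iff.1 he with ⟨rfl, -⟩ | ⟨-, h⟩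
        exacts [G.loopless.irrefl _ hy.2, hyy h.symm])
    rw [Walk.length_concat] at this
    rcases (by omega : q.length = g - 2 ∨ q.length = g - 1 ∨ q.length = g) with h | h | h
    · left; rw [← hqy, h]
    · right; left; rw [← hqy, h]
    · right; right
      rw [← hqy, h, ← hcg, ← Walk.length_rotate c y₀ hy₀, Walk.getVert_length]

/-- A graph on `W` of girth exactly `g` and large minimum degree in which small separations cut off
only small sets. -/
structure IsCore (H : SimpleGraph V) (W : Finset V) (g : ℕ) : Prop where
  three_le : 3 ≤ g
  nonempty : W.Nonempty
  mem_of_adj : ∀ x y, H.Adj x y → y ∈ W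
  girth : H.GirthAtLeast g
  exists_cycle : ∃ (w : V) (c : H.Walk w w), c.IsCycle ∧ c.length = g
  le_degIn : ∀ x ∈ W, 2 ^ 60 ≤ H.degIn W x
  small_side : ∀ A B : Finset V, A ∪ B = W →
    (∀ x y, H.Adj x y → (x ∈ A ∧ y ∈ A) ∨ (x ∈ B ∧ y ∈ B)) → (A ∩ B).card ≤ 3 * g →
      A.card < 6 * g ∨ B.card < 6 * g

theorem IsCore.degSum_le {H : SimpleGraph V} {W : Finset V} {g : ℕ} (h : H.IsCore W g)
    {U : Finset V} (hU : U.card ≤ 6 * g) : H.degSum U ≤ 2 * 1024 * U.card := by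
  by_contra! hd
  have := h.girth.lt_card_of_dense h.three_le hd
  omega

/-- Every dense graph contains a core. -/
theorem exists_isCore [Fintype V] [Nonempty V] (G : SimpleGraph V)
    (hG : 2 ^ 61 * Fintype.card V ≤ G.degSum Finset.univ) :
    ∃ (W : Finset V) (g : ℕ), (G.within (W : Set V)).IsCore W g := by
  -- The slack `6 * 2 ^ 60 * g` is the degree-sum equivalent of `3 g` vertices at density `2 ^ 61`:
  -- it pays for counting a separator of order `3 g` twice. As `6 g ≤ |W|`, it still leaves a degree
  -- sum above `2 ^ 60 |W|`.
  let Q : ℕ → Finset V → Prop := fun g W => 3 ≤ g ∧ (G.within (W : Set V)).GirthAtLeast g ∧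
    6 * g ≤ W.card ∧ 2 ^ 61 * W.card < G.degSum W + 6 * 2 ^ 60 * g
  have hn : 0 < Fintype.card V := Fintype.card_pos
  have hQ3 : Q 3 Finset.univ := by
    refine ⟨le_rfl, fun w c hc => hc.three_le_length, ?_, ?_⟩
    · have h1 := degSum_le_sq (G := G) Finset.univ
      rw [Finset.card_univ] at h1 ⊢
      have h2 := Nat.le_of_mul_le_mul_right (hG.trans h1) hn
      omega
    · rw [Finset.card_univ]; omega
  have hbd : ∀ g W, Q g W → g ≤ Fintype.card V := by
    intro g W h
    have := Finset.card_le_univ W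
    have := h.2.2.1
    omega
  obtain ⟨g, ⟨W₀, hW₀⟩, hgmax⟩ : ∃ g, (∃ W, Q g W) ∧ ∀ W, ¬ Q (g + 1) W := by
    by_contra! hno
    have : ∀ k, ∃ W, Q (3 + k) W := by
      intro k
      induction k with
      | zero => exact ⟨_, hQ3⟩
      | succ k ih => exact hno _ ih
    obtain ⟨W, hW⟩ := this (Fintype.card V)
    have := hbd _ _ hW
    omega
  obtain ⟨W, hW, hmin⟩ := (Finset.univ.filter (Q g)).exists_min_image Finset.card
    ⟨W₀, by simpa using hW₀⟩
  obtain ⟨h3, hg, h6, hd⟩ := (Finset.mem_filter.1 hW).2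
  have hsmall : ∀ U ⊂ W, 6 * g ≤ U.card → G.degSum U + 6 * 2 ^ 60 * g ≤ 2 ^ 61 * U.card := by
    intro U hU hUc
    by_contra! hlt
    have hQU : Q g U := ⟨h3, hg.mono (within_mono G (Finset.coe_subset.2 hU.subset)), hUc, hlt⟩
    have := hmin U (by simpa using hQU)
    have := Finset.card_lt_card hU
    omega
  have hdense : 2 * 1024 * W.card < (G.within (W : Set V)).degSum W := by
    rw [degSum_within subset_rfl]
    omega
  have h6' := hg.lt_card_of_dense h3 hdense
  have hne : W.Nonempty := Finset.card_pos.1 (by omega)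
  refine ⟨W, g, h3, hne, fun x y h => h.2.2, hg, ?_, ?_, ?_⟩
  · by_contra! hno
    have hg' : (G.within (W : Set V)).GirthAtLeast (g + 1) := by
      intro w c hc
      have := hg w c hc
      have := hno w c hc
      omega
    -- The density condition only weakens as `g` grows, and the Moore bound for girth `g + 1`
    -- supplies the size condition, contradicting the maximality of `g`.
    have := hg'.lt_card_of_dense (by omega) hdense
    exact hgmax W ⟨by omega, hg', by omega, by omega⟩
  · intro x hx
    rw [degIn_within subset_rfl hx]
    by_contra! hlt
    have h1 := Finset.card_erase_add_one hx
    have h2 := hsmall _ (Finset.erase_ssubset hx) (by omega)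
    have h3 := degSum_erase (G := G) hx
    omega
  · intro A B hAB hedge hcard
    by_contra! hbig
    have hcard' := Finset.card_union_add_card_inter A B
    rw [hAB] at hcard'
    have hAW : A ⊆ W := hAB ▸ Finset.subset_union_left
    have hBW : B ⊆ W := hAB ▸ Finset.subset_union_right
    have hA : A ⊂ W := by
      refine hAW.ssubset_of_ne ?_
      intro h
      rw [h, Finset.inter_eq_right.2 hBW] at hcard
      omega
    have hB : B ⊂ W := by
      refine hBW.ssubset_of_ne ?_
      intro h
      rw [h, Finset.inter_eq_left.2 hAW] at hcard
      omega
    -- Both sides miss the density condition, so together they are short by two slacks. The overlap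
    -- of at most `3 g` vertices restores only one of them, contradicting the density of `W`.
    have h1 := hsmall A hA hbig.1
    have h2 := hsmall B hB hbig.2
    have h3 := degSum_le_add (G := G) (W := W) (A := A) (B := B)
      fun x hx y hy hxy => hedge x y ⟨hxy, hx, hy⟩
    omega

/-! ### Terminals attached to a shortest cycle -/

/-- The graph `G` without the vertices in `C`, together with new vertices `i : ι` that have the
neighbours of `τ i` outside `C`. -/
def attach {ι : Type*} (G : SimpleGraph V) (C : Finset V) (τ : ι → V) : SimpleGraph (V ⊕ ι) where
  Adj
    | .inl x, .inl y => G.Adj x y ∧ x ∉ C ∧ y ∉ C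
    | .inl x, .inr i => G.Adj x (τ i) ∧ x ∉ C
    | .inr i, .inl x => G.Adj x (τ i) ∧ x ∉ C
    | .inr _, .inr _ => False
  symm := ⟨by
    rintro (x | i) (y | j) h
    exacts [⟨h.1.symm, h.2.2, h.2.1⟩, h, h, h]⟩
  loopless := ⟨by
    rintro (x | i) h
    exacts [G.loopless.irrefl _ h.1, h]⟩

theorem IsCliqueModel.attach {ι κ : Type*} {G : SimpleGraph V} {C : Finset V} {τ : ι → V}
    {B : κ → Set V} (hB : G.IsCliqueModel B) (hC : ∀ k, Disjoint (B k) (C : Set V)) :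
    ((G.attach C τ).completeOn (Set.range Sum.inr)).IsCliqueModel fun k => Sum.inl '' B k := by
  have hadj : ∀ k m, ∀ x ∈ B k, ∀ y ∈ B m, G.Adj x y →
      ((G.attach C τ).completeOn (Set.range Sum.inr)).Adj (Sum.inl x) (Sum.inl y) := by
    intro k m x hx y hy hxy
    refine ⟨fun h => hxy.ne (Sum.inl_injective h), .inl ⟨hxy, fun h => ?_, fun h => ?_⟩⟩
    exacts [Set.disjoint_left.1 (hC k) hx h, Set.disjoint_left.1 (hC m) hy h]
  refine ⟨fun k => (hB.nonempty k).image _, fun k => ?_, fun k m hkm => ?_, fun k m hkm => ?_⟩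
  · rintro U hU ⟨v, hv⟩ hcl
    obtain ⟨x, hx, rfl⟩ := hU hv
    have := hB.conn k {x | x ∈ B k ∧ Sum.inl x ∈ U} (fun _ h => h.1) ⟨x, hx, hv⟩ ?_
    · rintro - ⟨y, hy, rfl⟩
      exact (this hy).2
    · rintro a ⟨ha, haU⟩ b hb hab
      exact ⟨hb, hcl _ haU _ ⟨b, hb, rfl⟩ (hadj k k a ha b hb hab)⟩
  · exact Set.disjoint_image_of_injective Sum.inl_injective (hB.disj k m hkm)
  · obtain ⟨x, hx, y, hy, hxy⟩ := hB.adj k m hkm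
    exact ⟨_, ⟨x, hx, rfl⟩, _, ⟨y, hy, rfl⟩, hadj k m x hx y hy hxy⟩

/-- In a core, terminals attached to the vertices of a shortest cycle cannot be separated from a
large complete minor off the cycle. -/
theorem IsCore.wellAttached [Fintype V] {ι κ : Type*} [Fintype ι] [Fintype κ] {H : SimpleGraph V}
    {W : Finset V} {g : ℕ} (h : H.IsCore W g) {C : Finset V} (hCW : C ⊆ W) (hCg : C.card ≤ g)
    (hC : ∀ x, (C.filter (H.Adj x)).card ≤ 3) {τ : ι → V} (hτC : ∀ i, τ i ∈ C)
    (hτ : ∀ x, (Finset.univ.filter fun i => H.Adj x (τ i)).card ≤ 6)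
    (hι : Fintype.card ι = 2 * g) (hκ : 4 * g ≤ Fintype.card κ) {B : κ → Set V}
    (hB : H.IsCliqueModel B) (hBW : ∀ k, B k ⊆ W) (hBC : ∀ k, Disjoint (B k) (C : Set V)) :
    (H.attach C τ).WellAttached Sum.inr fun k => Sum.inl '' B k := by
  rintro S T hST hS ⟨k₀, hk₀⟩
  by_contra! hlt
  replace hlt : (S ∩ T).card < 2 * g := by
    rw [← hι]
    exact lt_of_le_of_lt (le_of_eq (by congr!)) hlt
  set S' := W.filter fun x => x ∉ C ∧ Sum.inl x ∈ S with hS'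
  set T' := W.filter fun x => x ∉ C ∧ Sum.inl x ∈ T with hT'
  have mS : ∀ x, x ∈ S' ↔ x ∈ W ∧ x ∉ C ∧ Sum.inl x ∈ S := by simp [hS']
  have mT : ∀ x, x ∈ T' ↔ x ∈ W ∧ x ∉ C ∧ Sum.inl x ∈ T := by simp [hT']
  have hedge : ∀ x y, H.Adj x y → x ∉ C → y ∉ C →
      (Sum.inl x ∈ S ∧ Sum.inl y ∈ S) ∨ (Sum.inl x ∈ T ∧ Sum.inl y ∈ T) :=
    fun x y hxy hx hy => hST.edge _ _ (show (H.attach C τ).Adj (.inl x) (.inl y) from ⟨hxy, hx, hy⟩)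
  -- free terminals
  set I := Finset.univ.filter fun i : ι => Sum.inr i ∉ T with hI
  -- All terminals lie in `S`, so those in `T` count towards the separator. Its order is below the
  -- number of terminals, so the free ones outnumber its remaining vertices.
  have hq : (S' ∩ T').card < I.card := by
    have h1 : (S' ∩ T').disjSum (Finset.univ.filter fun i : ι => ¬ Sum.inr i ∉ T) ⊆ S ∩ T := by
      rintro (x | i) hx
      · rw [Finset.inl_mem_disjSum, Finset.mem_inter, mS, mT] at hx
        exact Finset.mem_inter.2 ⟨hx.1.2.2, hx.2.2.2⟩
      · rw [Finset.inr_mem_disjSum, Finset.mem_filter, not_not] at hx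
        exact Finset.mem_inter.2 ⟨hS i, hx.2⟩
    have h2 := Finset.card_le_card h1
    rw [Finset.card_disjSum] at h2
    have h3 : I.card + (Finset.univ.filter fun i : ι => ¬ Sum.inr i ∉ T).card = 2 * g := by
      rw [← hι, ← Finset.card_univ, hI]
      convert Finset.card_filter_add_card_filter_not (s := Finset.univ)
        (fun i : ι => Sum.inr i ∉ T)
    omega
  have hIg : I.card ≤ 2 * g := hι ▸ Finset.card_le_univ I
  -- few neighbours are lost to `C`
  have hdeg : ∀ (D : Finset V) (x : V), x ∈ W → (∀ y ∈ W, y ∉ C → H.Adj x y → y ∈ D) →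
      2 ^ 60 - 3 ≤ H.degIn D x := by
    intro D x hx hD
    have h1 : W.filter (H.Adj x) ⊆ D.filter (H.Adj x) ∪ C.filter (H.Adj x) := by
      intro y hy
      rw [Finset.mem_filter] at hy
      rw [Finset.mem_union, Finset.mem_filter, Finset.mem_filter]
      by_cases hyC : y ∈ C
      · exact .inr ⟨hyC, hy.2⟩
      · exact .inl ⟨hD y hy.1 hyC hy.2, hy.2⟩
    have h2 := (Finset.card_le_card h1).trans (Finset.card_union_le _ _)
    have h3 := h.le_degIn x hx
    have h4 := hC x
    unfold degIn at h3 ⊢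
    omega
  -- a small side consists almost entirely of separator vertices
  have hside : ∀ D E : Finset V, (∀ x ∈ D, x ∉ E → x ∈ W ∧ ∀ y ∈ W, y ∉ C → H.Adj x y → y ∈ D) →
      (D ∪ C).card < 6 * g → 2 ^ 40 * (D \ E).card ≤ (D ∩ E).card := by
    intro D E hDE hD
    have h1 := mul_card_le_degSum (G := H) (W := D) (A := D \ E) (k := 2 ^ 60 - 3)
      Finset.sdiff_subset fun x hx => by
        rw [Finset.mem_sdiff] at hx
        exact hdeg D x (hDE x hx.1 hx.2).1 (hDE x hx.1 hx.2).2
    have h2 := Finset.card_le_card (Finset.subset_union_left : D ⊆ D ∪ C)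
    have h3 := h.degSum_le (U := D) (by omega)
    have h4 := Finset.card_sdiff_add_card_inter D E
    omega
  -- Returning `C` to both sides gives a separation of `H` of order less than `2 g + g`.
  have hsmall := h.small_side (S' ∪ C) (T' ∪ C) ?_ ?_ ?_
  · rcases hsmall with hsm | hsm
    · have h1 := hside S' T' (fun x hx hxT => by
        rw [mS] at hx
        refine ⟨hx.1, fun y hy hyC hxy => (mS y).2 ⟨hy, hyC, ?_⟩⟩
        refine ((hedge x y hxy hx.2.1 hyC).resolve_right fun hT => hxT ?_).2
        exact (mT x).2 ⟨hx.1, hx.2.1, hT.1⟩) hsm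
      -- Left side small: each free terminal sends at least `2 ^ 60 - 3` edges into `S'`, and each
      -- vertex of `S'` receives at most 6. But `S'` is hardly larger than `S' ∩ T'`, which is
      -- smaller than `I`.
      have h2 := Finset.card_mul_le_card_mul (s := I) (t := S') (fun i x => H.Adj (τ i) x)
        (m := 2 ^ 60 - 3) (n := 6) (fun i hi => by
          refine hdeg S' (τ i) (hCW (hτC i)) fun y hy hyC hiy => (mS y).2 ⟨hy, hyC, ?_⟩
          have hadj : (H.attach C τ).Adj (.inr i) (.inl y) := ⟨hiy.symm, hyC⟩
          exact ((hST.edge _ _ hadj).resolve_right fun hT => (Finset.mem_filter.1 hi).2 hT.1).2)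
        (fun x _ => by
          refine (Finset.card_le_card fun i hi => ?_).trans (hτ x)
          rw [Finset.mem_bipartiteBelow] at hi
          simpa using hi.2.symm)
      have h3 := Finset.card_sdiff_add_card_inter S' T'
      omega
    · have h1 := hside T' S' (fun x hx hxS => by
        rw [mT] at hx
        refine ⟨hx.1, fun y hy hyC hxy => (mT y).2 ⟨hy, hyC, ?_⟩⟩
        refine ((hedge x y hxy hx.2.1 hyC).resolve_left fun hS => hxS ?_).2
        exact (mS x).2 ⟨hx.1, hx.2.1, hS.1⟩) hsm
      have hk₀S : ∀ x ∈ B k₀, Sum.inl x ∉ S := fun x hx hxS =>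
        Set.disjoint_left.1 hk₀ ⟨x, hx, rfl⟩ hxS
      have hBC' : ∀ k, ∀ x ∈ B k, x ∉ C := fun k x hx hxC => Set.disjoint_left.1 (hBC k) hx hxC
      -- Right side small: every branch set is `B k₀` or adjacent to it, hence meets `T'`. So `T'`
      -- has at least `4 g` vertices, though it is hardly larger than `S' ∩ T'`, of size below `2
      -- g`.
      have hmeet : ∀ k, ∃ x ∈ B k, x ∈ T' := by
        intro k
        by_cases hk : k₀ = k
        · subst hk
          obtain ⟨x, hx⟩ := hB.nonempty k₀
          exact ⟨x, hx, (mT x).2 ⟨hBW _ hx, hBC' _ x hx,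
            (hST.cover _).resolve_left (hk₀S x hx)⟩⟩
        · obtain ⟨x, hx, y, hy, hxy⟩ := hB.adj k₀ k hk
          refine ⟨y, hy, (mT y).2 ⟨hBW _ hy, hBC' _ y hy, ?_⟩⟩
          exact ((hedge x y hxy (hBC' _ x hx) (hBC' _ y hy)).resolve_left
            fun hS => hk₀S x hx hS.1).2
      choose f hf hfT using hmeet
      have h2 := Finset.card_le_card_of_injOn (s := Finset.univ) f (fun k _ => hfT k)
        (fun k _ m _ hkm => hB.eq_of_mem (hf k) (by rw [hkm]; exact hf m))
      rw [Finset.card_univ] at h2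
      have h3 := Finset.card_sdiff_add_card_inter T' S'
      rw [Finset.inter_comm T'] at h1 h3
      have := h.three_le
      omega
  · ext x
    simp only [Finset.mem_union, mS, mT]
    constructor
    · rintro ((h | h) | h | h)
      exacts [h.1, hCW h, h.1, hCW h]
    · intro hx
      have := hST.cover (.inl x)
      tauto
  · intro x y hxy
    simp only [Finset.mem_union, mS, mT]
    have h1 := h.mem_of_adj x y hxy
    have h2 := h.mem_of_adj y x hxy.symm
    by_cases hxC : x ∈ C <;> by_cases hyC : y ∈ C
    · exact .inl ⟨.inr hxC, .inr hyC⟩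
    · rcases hST.cover (.inl y) with h | h
      exacts [.inl ⟨.inr hxC, .inl ⟨h1, hyC, h⟩⟩, .inr ⟨.inr hxC, .inl ⟨h1, hyC, h⟩⟩]
    · rcases hST.cover (.inl x) with h | h
      exacts [.inl ⟨.inl ⟨h2, hxC, h⟩, .inr hyC⟩, .inr ⟨.inl ⟨h2, hxC, h⟩, .inr hyC⟩]
    · rcases hedge x y hxy hxC hyC with h | h
      exacts [.inl ⟨.inl ⟨h2, hxC, h.1⟩, .inl ⟨h1, hyC, h.2⟩⟩,
        .inr ⟨.inl ⟨h2, hxC, h.1⟩, .inl ⟨h1, hyC, h.2⟩⟩]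
  · have h1 : (S' ∪ C) ∩ (T' ∪ C) ⊆ (S' ∩ T') ∪ C := by
      intro x
      simp only [Finset.mem_inter, Finset.mem_union]
      tauto
    have h2 := (Finset.card_le_card h1).trans (Finset.card_union_le _ _)
    omega

/-- A connected set of the attached graph that contains the terminals `i` and `j` only yields a path
of `G` off `C` between neighbours of `τ i` and `τ j`. -/
theorem ConnOn.exists_path_of_attach {ι : Type*} {G : SimpleGraph V} {C : Finset V} {τ : ι → V}
    {P : Set (V ⊕ ι)} (hP : (G.attach C τ).ConnOn P) {i j : ι} (hij : i ≠ j) (hi : Sum.inr i ∈ P)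
    (hj : Sum.inr j ∈ P) (honly : ∀ m, Sum.inr m ∈ P → m = i ∨ m = j) :
    ∃ (x y : V) (q : G.Walk x y), q.IsPath ∧ (∀ v ∈ q.support, v ∉ C ∧ Sum.inl v ∈ P) ∧
      G.Adj (τ i) x ∧ G.Adj y (τ j) := by
  suffices h : ∃ (x y : V) (q : G.Walk x y), (∀ v ∈ q.support, v ∉ C ∧ Sum.inl v ∈ P) ∧
      G.Adj (τ i) x ∧ G.Adj y (τ j) by
    obtain ⟨x, y, q, hq, h1, h2⟩ := h
    exact ⟨x, y, q.bypass, q.bypass_isPath, fun v hv => hq v (q.support_bypass_subset_support hv),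
      h1, h2⟩
  by_contra! hno
  -- The part of `P` reached from terminal `i` through non-terminals. If no path arrives next to `τ
  -- j`, it is closed and misses terminal `j`.
  let U : Set (V ⊕ ι) := {v | v = Sum.inr i ∨ ∃ y, v = Sum.inl y ∧ ∃ (x : V) (q : G.Walk x y),
    (∀ v ∈ q.support, v ∉ C ∧ Sum.inl v ∈ P) ∧ G.Adj (τ i) x}
  have := hP U ?_ ⟨Sum.inr i, .inl rfl⟩ ?_ hj
  · rcases this with h | ⟨y, h, -⟩
    · exact hij (Sum.inr_injective h).symm
    · exact Sum.inr_ne_inl h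
  · rintro v (rfl | ⟨y, rfl, x, q, hq, -⟩)
    exacts [hi, (hq y q.end_mem_support).2]
  · rintro v (rfl | ⟨y, rfl, x, q, hq, hx⟩) (z | m) hz hadj
    · refine .inr ⟨z, rfl, z, .nil, ?_, hadj.1.symm⟩
      simpa using ⟨hadj.2, hz⟩
    · exact hadj.elim
    · refine .inr ⟨z, rfl, x, q.concat hadj.1, fun v hv => ?_, hx⟩
      rw [Walk.support_concat] at hv
      rcases (by simpa using hv : v ∈ q.support ∨ v = z) with hv | rfl
      exacts [hq v hv, ⟨hadj.2.2, hz⟩]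
    · rcases honly m hz with rfl | rfl
      · exact .inl rfl
      · exact (hno x y q hq hx hadj.1).elim

/-! ### Assembling the outer cycle -/

/-- Paths between consecutive vertices of `w` through disjoint sets concatenate to a walk that is
simple up to its starting vertex and visits the vertices of `w` in order. -/
theorem exists_concat {G : SimpleGraph V} {C : Finset V} {w : ℕ → V} {R : ℕ → Set V} {g : ℕ}
    (hwC : ∀ a, w a ∈ C) (hw : ∀ a b, 1 ≤ a → a < b → b ≤ g → w a ≠ w b)
    (hR : ∀ a b, a < b → b < g → Disjoint (R a) (R b)) (hRC : ∀ a < g, ∀ x ∈ R a, x ∉ C)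
    (hp : ∀ a < g, ∃ p : G.Walk (w a) (w (a + 1)), 2 ≤ p.length ∧ p.support.tail.Nodup ∧
      (∀ x ∈ p.support.tail, x ∈ R a ∨ x = w (a + 1)) ∧ ∀ e ∈ p.edges, ∃ x ∈ e, x ∉ C) :
    ∀ k ≤ g, ∃ (Q : G.Walk (w 0) (w k)) (pos : ℕ → ℕ), pos 0 = 0 ∧ pos k = Q.length ∧
      StrictMonoOn pos (Set.Iic k) ∧ (∀ a ≤ k, Q.getVert (pos a) = w a) ∧ 2 * k ≤ Q.length ∧
      Q.support.tail.Nodup ∧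
      (∀ x ∈ Q.support.tail, (∃ a, 1 ≤ a ∧ a ≤ k ∧ x = w a) ∨ ∃ a < k, x ∈ R a) ∧
      ∀ e ∈ Q.edges, ∃ x ∈ e, x ∉ C := by
  intro k
  induction k with
  | zero =>
    refine fun _ => ⟨.nil, id, rfl, rfl, strictMonoOn_id, fun a ha => ?_, le_rfl, by simp, by simp,
      by simp⟩
    rw [Nat.le_zero.1 ha]; rfl
  | succ k ih =>
    intro hk
    obtain ⟨Q, pos, h0, hlen, hmono, hpos, hQ2, hnd, hsupp, hed⟩ := ih (by omega)
    obtain ⟨p, hp2, hpnd, hpsupp, hped⟩ := hp k (by omega)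
    have hold : ∀ a ≤ k, Function.update pos (k + 1) (Q.length + p.length) a = pos a :=
      fun a ha => Function.update_of_ne (by omega) _ _
    have hle : ∀ a ≤ k, pos a ≤ Q.length := fun a ha => by
      rw [← hlen]
      exact hmono.monotoneOn (Set.mem_Iic.2 ha) (Set.mem_Iic.2 le_rfl) ha
    refine ⟨Q.append p, Function.update pos (k + 1) (Q.length + p.length), ?_, ?_, ?_, ?_, ?_, ?_,
      ?_, ?_⟩
    · rw [hold 0 (Nat.zero_le _), h0]
    · rw [Function.update_self, Walk.length_append]
    · intro a ha b hb hab
      rw [Set.mem_Iic] at ha hb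
      rw [hold a (by omega)]
      by_cases hbk : b ≤ k
      · rw [hold b hbk]
        exact hmono (Set.mem_Iic.2 (by omega)) (Set.mem_Iic.2 hbk) hab
      · rw [show b = k + 1 by omega, Function.update_self]
        have := hle a (by omega)
        omega
    · intro a ha
      by_cases hak : a ≤ k
      · rw [hold a hak, Walk.getVert_append']
        rw [if_pos (hle a hak)]
        exact hpos a hak
      · rw [show a = k + 1 by omega, Function.update_self, ← Walk.length_append,
          Walk.getVert_length]
    · rw [Walk.length_append]; omega
    · rw [Walk.tail_support_append, List.nodup_append']
      refine ⟨hnd, hpnd, fun x hx hx' => ?_⟩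
      rcases hsupp x hx with ⟨a, ha1, hak, rfl⟩ | ⟨a, hak, hxa⟩
      · rcases hpsupp _ hx' with h | h
        · exact hRC k (by omega) _ h (hwC a)
        · exact hw a (k + 1) ha1 (by omega) hk h
      · rcases hpsupp _ hx' with h | h
        · exact Set.disjoint_left.1 (hR a k hak (by omega)) hxa h
        · exact hRC a (by omega) x hxa (h ▸ hwC _)
    · intro x hx
      rw [Walk.tail_support_append, List.mem_append] at hx
      rcases hx with hx | hx
      · rcases hsupp x hx with ⟨a, ha1, hak, rfl⟩ | ⟨a, hak, hxa⟩
        exacts [.inl ⟨a, ha1, by omega, rfl⟩, .inr ⟨a, by omega, hxa⟩]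
      · rcases hpsupp x hx with h | h
        exacts [.inr ⟨k, by omega, h⟩, .inl ⟨k + 1, by omega, le_rfl, h⟩]
    · intro e he
      rw [Walk.edges_append, List.mem_append] at he
      exact he.elim (hed e) (hped e)

/-- A cycle whose edges have pairwise disjoint detours is the inner cycle of a nested pair. -/
theorem hasNested_of_detours {G : SimpleGraph V} {u : V} {c : G.Walk u u} (hc : c.IsCycle)
    {R : ℕ → Set V} (hR : ∀ a b, a < b → b < c.length → Disjoint (R a) (R b))
    (hp : ∀ a < c.length, ∃ (x y : V) (q : G.Walk x y), q.IsPath ∧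
      (∀ v ∈ q.support, v ∉ c.support ∧ v ∈ R a) ∧ G.Adj (c.getVert a) x ∧
      G.Adj y (c.getVert (a + 1))) :
    G.HasNestedCyclesWithoutCrossings := by
  have h3 := hc.three_le_length
  obtain ⟨Q, pos, h0, hlen, hmono, hpos, hQ2, hnd, -, hed⟩ := exists_concat (G := G)
    (C := c.support.toFinset) (w := c.getVert) (R := fun a => {x | x ∈ R a ∧ x ∉ c.support})
    (g := c.length) (fun a => by simp)
    (fun a b ha hab hb h => by
      have := hc.getVert_injOn (Set.mem_ofPred.2 ⟨ha, by omega⟩) (Set.mem_ofPred.2 ⟨by omega, hb⟩) h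
      omega)
    (fun a b hab hb => (hR a b hab hb).mono (fun _ h => h.1) (fun _ h => h.1))
    (fun a _ x hx => by simpa using hx.2)
    (fun a ha => by
      obtain ⟨x, y, q, hq, hqs, hx, hy⟩ := hp a ha
      refine ⟨.cons hx (q.concat hy), by simp, ?_, ?_, ?_⟩
      · rw [Walk.support_cons, List.tail_cons]
        refine (Walk.isPath_def _).1 (hq.concat (fun h => ?_) hy)
        exact (hqs _ h).1 (c.getVert_mem_support _)
      · intro v hv
        rw [Walk.support_cons, List.tail_cons, Walk.support_concat] at hv
        rcases (by simpa using hv : v ∈ q.support ∨ v = _) with hv | hv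
        exacts [.inl ⟨(hqs v hv).2, (hqs v hv).1⟩, .inr hv]
      · intro e he
        rw [Walk.edges_cons, Walk.edges_concat] at he
        have he' : e = s(c.getVert a, x) ∨ e ∈ q.edges ∨ e = s(y, c.getVert (a + 1)) := by
          simpa using he
        have key : ∀ v ∈ q.support, v ∉ c.support.toFinset := fun v hv => by
          simpa using (hqs v hv).1
        rcases he' with rfl | he | rfl
        · exact ⟨x, by simp, key x q.start_mem_support⟩
        · induction e with | _ v v'
          exact ⟨v, by simp, key v (q.fst_mem_support_of_mem_edges he)⟩
        · exact ⟨y, by simp, key y q.end_mem_support⟩)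
    c.length le_rfl
  have hend : c.getVert c.length = u := c.getVert_length
  obtain ⟨C₁, hlen, hpos, hQ2, hnd, hed⟩ : ∃ C₁ : G.Walk u u, pos c.length = C₁.length ∧
      (∀ a ≤ c.length, C₁.getVert (pos a) = c.getVert a) ∧ 2 * c.length ≤ C₁.length ∧
      C₁.support.tail.Nodup ∧ ∀ e ∈ C₁.edges, ∃ x ∈ e, x ∉ c.support.toFinset := by
    refine ⟨Q.copy c.getVert_zero hend, ?_, fun a ha => ?_, ?_, ?_, ?_⟩
    · simpa using hlen
    · simpa using hpos a ha
    · simpa using hQ2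
    · simpa using hnd
    · simpa using hed
  have hC₁ : C₁.IsCycle := by
    rw [Walk.isCycle_iff_isPath_tail_and_le_length]
    refine ⟨?_, by omega⟩
    rw [Walk.isPath_def, Walk.support_tail_of_not_nil]
    · exact hnd
    · rw [← Walk.length_eq_zero_iff]; omega
  have hpos_lt : ∀ a < c.length, pos a < C₁.length := fun a ha => by
    rw [← hlen]
    exact hmono (Set.mem_Iic.2 ha.le) (Set.mem_Iic.2 le_rfl) ha
  have hinj : ∀ n < C₁.length, ∀ a < c.length, C₁.getVert n = c.getVert a → n = pos a := by
    intro n hn a ha hna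
    have := hpos_lt a ha
    rw [← hpos a ha.le] at hna
    exact hC₁.getVert_injOn' (Set.mem_ofPred.2 (by omega)) (Set.mem_ofPred.2 (by omega)) hna
  -- Along `C₁`, an edge of `c` joins two consecutive stops, or the first and the last stop.
  have hedge : ∀ n m, n < m → m < C₁.length → s(C₁.getVert n, C₁.getVert m) ∈ c.edges →
      (∃ a, a + 1 < c.length ∧ n = pos a ∧ m = pos (a + 1)) ∨
      (n = 0 ∧ m = pos (c.length - 1)) := by
    intro n m hnm hm he
    obtain ⟨a, ha, hae⟩ := (c.mk_mem_edges_iff_exists).1 he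
    by_cases hag : a + 1 < c.length
    · left
      rcases Sym2.eq_iff.1 hae with ⟨h1, h2⟩ | ⟨h1, h2⟩
      · exact ⟨a, hag, hinj n (by omega) a ha h1.symm, hinj m hm _ hag h2.symm⟩
      · have e1 := hinj m hm a ha h1.symm
        have e2 := hinj n (by omega) _ hag h2.symm
        have := hmono (Set.mem_Iic.2 ha.le) (Set.mem_Iic.2 hag.le) (Nat.lt_succ_self a)
        omega
    · right
      have hal : a + 1 = c.length := by omega
      have hz : c.getVert (a + 1) = c.getVert 0 := by rw [hal, hend, c.getVert_zero]
      rw [hz] at hae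
      have ha' : c.length - 1 = a := by omega
      rw [ha']
      rcases Sym2.eq_iff.1 hae with ⟨h1, h2⟩ | ⟨h1, h2⟩
      · have := hinj m hm 0 (by omega) h2.symm
        omega
      · exact ⟨(hinj n (by omega) 0 (by omega) h2.symm).trans h0, hinj m hm a ha h1.symm⟩
  refine ⟨u, u, C₁, c, hC₁, hc, fun x hx => ?_, fun e he he' => ?_, ?_⟩
  · obtain ⟨a, rfl, ha⟩ := Walk.mem_support_iff_exists_getVert.1 hx
    rw [← hpos a ha]
    exact C₁.getVert_mem_support _
  · obtain ⟨x, hx, hxc⟩ := hed e he'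
    refine hxc (List.mem_toFinset.2 ?_)
    exact c.mem_support_of_mem_edges he hx
  -- Nothing starts strictly between consecutive stops in order to cross, and a chord from position
  -- 0 to the last stop encloses every other edge of `c`.
  · rintro i j i' j' hij hji' hij' hj' ⟨h1, h2⟩
    rcases hedge i i' (by omega) (by omega) h1 with ⟨a, ha, rfl, rfl⟩ | ⟨rfl, rfl⟩ <;>
      rcases hedge j j' (by omega) hj' h2 with ⟨b, hb, rfl, rfl⟩ | ⟨rfl, rfl⟩
    · have e1 := (hmono.lt_iff_lt (Set.mem_Iic.2 (by omega)) (Set.mem_Iic.2 (by omega))).1 hij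
      have e2 := (hmono.lt_iff_lt (Set.mem_Iic.2 (by omega)) (Set.mem_Iic.2 (by omega))).1 hji'
      omega
    · omega
    · have e1 := (hmono.lt_iff_lt (Set.mem_Iic.2 (by omega)) (Set.mem_Iic.2 (by omega))).1 hij'
      omega
    · omega

/-! ### From cores to the theorem -/

theorem HasNestedCyclesWithoutCrossings.mono {G H : SimpleGraph V}
    (h : H.HasNestedCyclesWithoutCrossings) (hle : H ≤ G) :
    G.HasNestedCyclesWithoutCrossings := by
  obtain ⟨u, w, c₁, c₂, h⟩ := h
  exact ⟨u, w, c₁.mapLe hle, c₂.mapLe hle, h.isCycle_outer.mapLe hle, h.isCycle_inner.mapLe hle,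
    by simpa using h.nested, by simpa using h.edge_disjoint, by simpa using h.no_crossing⟩

theorem IsCore.hasNestedCyclesWithoutCrossings [Fintype V] {H : SimpleGraph V} {W : Finset V}
    {g : ℕ} (h : H.IsCore W g) : H.HasNestedCyclesWithoutCrossings := by
  obtain ⟨u, c, hc, hcg⟩ := h.exists_cycle
  have h3 := h.three_le
  set C := c.support.toFinset with hCdef
  have mC : ∀ a, c.getVert a ∈ C := fun a => by simp [hCdef]
  have hCimg : C ⊆ (Finset.range g).image c.getVert := by
    intro x hx
    obtain ⟨a, rfl, ha⟩ := Walk.mem_support_iff_exists_getVert.1 (List.mem_toFinset.1 hx)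
    rcases ha.eq_or_lt with rfl | ha
    · exact Finset.mem_image.2 ⟨0, Finset.mem_range.2 (by omega), by simp⟩
    · exact Finset.mem_image.2 ⟨a, Finset.mem_range.2 (by omega), rfl⟩
  have hCg : C.card ≤ g := by
    have := (Finset.card_le_card hCimg).trans Finset.card_image_le
    rwa [Finset.card_range] at this
  have hCW : C ⊆ W := by
    intro x hx
    obtain ⟨a, ha, rfl⟩ := Finset.mem_image.1 (hCimg hx)
    exact h.mem_of_adj _ _ (c.adj_getVert_succ (by rw [hcg]; exact Finset.mem_range.1 ha)).symm
  obtain ⟨B, hB, hBW⟩ := h.girth.exists_isCliqueModel h3 h.nonempty h.mem_of_adj h.le_degIn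
  let κ := {k : Fin (5 * g) // Disjoint (B k) (C : Set V)}
  -- The cycle has at most `g` vertices and each spoils at most one of the `5 g` branch sets; the
  -- linkage lemma needs twice the number `2 g` of terminals.
  have hκ : 4 * g ≤ Fintype.card κ := by
    have h1 : (Finset.univ.filter fun k => ¬ Disjoint (B k) (C : Set V)).card ≤ C.card := by
      have : ∀ k, ∃ x, ¬ Disjoint (B k) (C : Set V) → x ∈ B k ∧ x ∈ C := by
        intro k
        by_cases hk : Disjoint (B k) (C : Set V)
        · exact ⟨u, fun h => (h hk).elim⟩
        · obtain ⟨x, hx⟩ := Set.not_disjoint_iff.1 hk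
          exact ⟨x, fun _ => hx⟩
      choose f hf using this
      refine Finset.card_le_card_of_injOn f (fun k hk => (hf k (by simpa using hk)).2) ?_
      intro k hk m hm hkm
      exact hB.eq_of_mem (hf k (by simpa using hk)).1
        (by rw [hkm]; exact (hf m (by simpa using hm)).1)
    have h2 := Finset.card_filter_add_card_filter_not (s := Finset.univ)
      (fun k => Disjoint (B k) (C : Set V))
    rw [Finset.card_univ, Fintype.card_fin] at h2
    rw [Fintype.card_subtype]
    omega
  -- The terminals `(a, true)` and `(a, false)` are copies of the two ends of the `a`-th edge of
  -- `c`. Each vertex of `c` thus has two copies, whence the bound `6 = 2 * 3` in `hτ`.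
  let τ : Fin g × Bool → V := fun i => c.getVert (i.1 + if i.2 then 0 else 1)
  have hτinj : ∀ i j, τ i = τ j → i.2 = j.2 → i = j := by
    rintro ⟨⟨i, hi⟩, b⟩ ⟨⟨j, hj⟩, b'⟩ hij rfl
    have : i = j := by
      cases b
      · have := hc.getVert_injOn (x₁ := i + 1) (x₂ := j + 1) (Set.mem_ofPred.2 (by omega))
          (Set.mem_ofPred.2 (by omega)) hij
        omega
      · exact hc.getVert_injOn' (x₁ := i) (x₂ := j) (Set.mem_ofPred.2 (by omega))
          (Set.mem_ofPred.2 (by omega)) hij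
    subst this
    rfl
  have hC3 := h.girth.card_adj_cycle_le hc hcg
  have hτ : ∀ x, (Finset.univ.filter fun i => H.Adj x (τ i)).card ≤ 6 := by
    intro x
    have h1 : (Finset.univ.filter fun i => H.Adj x (τ i)).card ≤
        (C.filter (H.Adj x) ×ˢ (Finset.univ : Finset Bool)).card := by
      refine Finset.card_le_card_of_injOn (fun i => (τ i, i.2)) (fun i hi => ?_) ?_
      · simp only [Finset.coe_filter, Finset.mem_univ, true_and, Set.mem_ofPred_eq] at hi
        simp only [Finset.coe_product, Set.mem_prod, Finset.mem_coe, Finset.mem_filter,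
          Finset.mem_univ, and_true]
        exact ⟨mC _, hi⟩
      · intro i _ j _ hij
        exact hτinj i j (Prod.ext_iff.1 hij).1 (Prod.ext_iff.1 hij).2
    rw [Finset.card_product, Finset.card_univ, Fintype.card_bool] at h1
    have : (C.filter (H.Adj x)).card ≤ 3 := hC3 x
    omega
  have hB' : H.IsCliqueModel fun k : κ => B k.1 :=
    ⟨fun k => hB.nonempty _, fun k => hB.conn _,
      fun k m hkm => hB.disj _ _ fun h => hkm (Subtype.ext h),
      fun k m hkm => hB.adj _ _ fun h => hkm (Subtype.ext h)⟩
  have hι : Fintype.card (Fin g × Bool) = 2 * g := by simp [mul_comm]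
  obtain ⟨P, hP1, hP2, hP3⟩ := WellAttached.linked (ι := Fin g × Bool) (κ := κ) (by omega) _
    (H.attach C τ) Sum.inr (fun k => Sum.inl '' B k.1) (fun i => i.1) le_rfl Sum.inr_injective
    (fun _ _ h => h) (hB'.attach fun k => k.2)
    (h.wellAttached hCW hCg hC3 (fun i => mC _) hτ hι hκ hB' (fun k => hBW _) fun k => k.2)
  refine hasNested_of_detours hc
    (R := fun a => {x | ∃ ha : a < g, Sum.inl x ∈ P ⟨a, ha⟩}) (fun a b hab hb => ?_) fun a ha => ?_
  · rw [Set.disjoint_left]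
    rintro x ⟨ha, hx⟩ ⟨hb, hx'⟩
    exact Set.disjoint_left.1 (hP1 _ _ (by simpa using hab.ne)) hx hx'
  · have hag : a < g := hcg ▸ ha
    obtain ⟨x, y, q, hq, hqs, hx, hy⟩ := (hP2 ⟨a, hag⟩).exists_path_of_attach
      (i := (⟨a, hag⟩, true)) (j := (⟨a, hag⟩, false)) (by simp) (hP3 (⟨a, hag⟩, true))
      (hP3 (⟨a, hag⟩, false)) (fun m hm => by
        have : m.1 = ⟨a, hag⟩ := by
          by_contra hne
          exact Set.disjoint_left.1 (hP1 _ _ hne) (hP3 m) hm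
        rcases m with ⟨m, b⟩
        cases b <;> simp_all)
    exact ⟨x, y, q, hq, fun v hv => ⟨fun h => (hqs v hv).1 (by simpa [hCdef] using h),
      hag, (hqs v hv).2⟩, hx, hy⟩

theorem hasNestedCyclesWithoutCrossings_of_dense [Fintype V] [Nonempty V] (G : SimpleGraph V)
    [DecidableRel G.Adj] (hG : 2 ^ 60 * Fintype.card V ≤ G.edgeFinset.card) :
    G.HasNestedCyclesWithoutCrossings := by
  have hsum : G.degSum Finset.univ = 2 * G.edgeFinset.card := by
    rw [← sum_degrees_eq_twice_card_edges]
    refine Finset.sum_congr rfl fun x _ => ?_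
    rw [← card_neighborFinset_eq_degree]
    unfold degIn
    congr 1
    ext y
    simp
  obtain ⟨W, g, h⟩ := exists_isCore G (by rw [hsum]; omega)
  exact h.hasNestedCyclesWithoutCrossings.mono (within_le _ _)

end SimpleGraph

theorem theorem1p1 :
    (∃ C : ℝ, 0 < C ∧ ∀ (V : Type u) [Fintype V] (G : SimpleGraph V) [DecidableRel G.Adj],
      C ≤ G.averageDegree → G.HasNestedCyclesWithoutCrossings) ∧
    (∃ C : ℝ, 0 < C ∧ ∀ (V : Type u) [Fintype V] [Nonempty V] (G : SimpleGraph V)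
      [DecidableRel G.Adj],
      C * (Fintype.card V : ℝ) ≤ (G.edgeFinset.card : ℝ) →
        G.HasNestedCyclesWithoutCrossings) := by
  refine ⟨⟨2 ^ 61, by positivity, fun V _ G _ h => ?_⟩, ⟨2 ^ 60, by positivity,
    fun V _ _ G _ h => G.hasNestedCyclesWithoutCrossings_of_dense (by exact_mod_cast h)⟩⟩
  unfold SimpleGraph.averageDegree at h
  rcases isEmpty_or_nonempty V with hV | hV
  -- On the empty vertex type the average degree is `0 / 0 = 0`, below the threshold.
  · norm_num at h
  · have hpos : (0 : ℝ) < Fintype.card V := by exact_mod_cast Fintype.card_pos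
    rw [le_div_iff₀ hpos] at h
    refine G.hasNestedCyclesWithoutCrossings_of_dense ?_
    have h' : (2 : ℝ) ^ 60 * Fintype.card V ≤ G.edgeFinset.card := by linarith
    exact_mod_cast h'
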